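/- Let $G$ be a group with neutral element $e_0$, let $Y\subseteq G$ be a finite set with at least two elements such that every element of $G$ is a product of elements of $Y$, let $F:Y\to\mathbb R$ be a function and let $\beta\in\mathbb R$. For a finite word $t=(t_1,\dots,t_n)$ over $Y$ (the empty word included) put $\overline t=t_1t_2\cdots t_n\in G$, $F(t)=\sum_{j}F(t_j)$, and let $tY^{\mathbb N}$ be the set of elements of $Y^{\mathbb N}$ that begin with $t$. Let $O_Y$ be the Cuntz algebra generated by isometries $V_s$, $s\in Y$, with $\sum_{s\in Y}V_sV_s^*=1$; put $V_t=V_{t_1}\cdots V_{t_n}$, and let $O_Y(G)\subseteq O_Y$ be the closed linear span of the elements $V_tV_u^*$ with $\overline t=\overline u$ (this $C^*$-algebra is a copy of the corner $P_{e_0}C^*(\Gamma)P_{e_0}$ of the graph $C^*$-algebra of the Cayley graph $\Gamma$ of $(G,Y)$). Let $\alpha^F$ be the one-parameter group of automorphisms of $O_Y(G)$ with $\alpha^F_r(V_tV_u^*)=e^{ir(F(t)-F(u))}V_tV_u^*$, and let $E:O_Y\to C(Y^{\mathbb N})$ be the conditional expectation with $E(V_tV_t^*)=1_{tY^{\mathbb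 N}}$ and $E(V_tV_u^*)=0$ for $t\neq u$. A state $\omega$ on $O_Y(G)$ is a $\beta$-KMS state for $\alpha^F$ if there is a dense $\alpha^F$-invariant $*$-subalgebra $\mathcal A$ of $O_Y(G)$ consisting of entire analytic elements for $\alpha^F$ such that $\omega(ab)=\omega(b\,\alpha^F_{i\beta}(a))$ for all $a,b\in\mathcal A$. A Borel probability measure $m$ on $Y^{\mathbb N}$ is a $\beta$-KMS measure if $a\mapsto\int_{Y^{\mathbb N}}E(a)\,\mathrm dm$ is a $\beta$-KMS state on $O_Y(G)$; it is abelian if $m(t_1t_2t_3Y^{\mathbb N})=m(t_1t_3t_2Y^{\mathbb N})$ for all finite words $t_1,t_2,t_3$; and it is the Bernoulli measure of a probability vector $p:Y\to[0,1]$, $\sum_{s\in Y} p(s)=1$, if $m(tY^{\mathbb N})=\prod_i p(t_i)$ for all finite words $t$. Assume that the abelianization $G/[G,G]$ is finite (possibly trivial). 1. There is an abelian $\beta$-KMS measure if and only if $\sum_{s\in Y}e^{-\beta F(s)}=1$. When it exists, the abelian $\beta$-KMS measure is unique, and it is the Bernoulli measure of the probability vector $p(s)=e^{-\beta F(s)}$.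 2. If moreover $G$ is nilpotent, then there is a $\beta$-KMS measure (abelian or not) if and only if $\sum_{s\in Y}e^{-\beta F(s)}=1$. When it exists, the $\beta$-KMS measure is unique, and it is the Bernoulli measure of the probability vector $p(s)=e^{-\beta F(s)}$. -/

import Mathlib

open MeasureTheory

noncomputable section

namespace CayleyKMS

open scoped Classical

/-! ### Infinite words over a finite alphabet `S` -/

/-- The space of infinite words over the alphabet `S`. -/
def PathSpace (S : Type*) : Type _ := ℕ → S

/-- The product topology of the discrete topologies. -/
instance (S : Type*) : TopologicalSpace (PathSpace S) :=
  @Pi.topologicalSpace ℕ (fun _ => S) (fun _ => ⊥)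

/-- The Borel sigma-algebra. -/
instance (S : Type*) : MeasurableSpace (PathSpace S) := borel _

instance (S : Type*) : BorelSpace (PathSpace S) := ⟨rfl⟩

/-- The infinite word `s x₀ x₁ x₂ ⋯`. -/
def PathSpace.cons {S : Type*} (s : S) (x : PathSpace S) : PathSpace S
  | 0 => s
  | n + 1 => x n

/-- The infinite word `x` without its first letter. -/
def PathSpace.tail {S : Type*} (x : PathSpace S) : PathSpace S := fun n => x (n + 1)

/-- The cylinder set of all infinite words which begin with the finite word `t`. -/
def cylinder {S : Type*} (t : List S) : Set (PathSpace S) :=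
  {x | ∀ i : Fin t.length, x i = t.get i}

/-- `m` is the Bernoulli measure (infinite product measure) defined by the probability
vector `p`. -/
def IsBernoulli {S : Type*} [Fintype S] (m : ProbabilityMeasure (PathSpace S)) (p : S → ℝ) :
    Prop :=
  (∀ s, 0 ≤ p s ∧ p s ≤ 1) ∧ ∑ s, p s = 1 ∧
    ∀ t : List S, (m : Measure (PathSpace S)) (cylinder t) = ENNReal.ofReal (t.map p).prod

/-- Invariance of the measure of cylinders under interchanging finite blocks. -/
def IsAbelianMeasure {S : Type*} (m : ProbabilityMeasure (PathSpace S)) : Prop :=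
  ∀ t₁ t₂ t₃ : List S, (m : Measure (PathSpace S)) (cylinder (t₁ ++ t₂ ++ t₃)) =
    (m : Measure (PathSpace S)) (cylinder (t₁ ++ t₃ ++ t₂))

/-- The value on a finite word of a potential which is given on letters. -/
def potential {S : Type*} (F : S → ℝ) (t : List S) : ℝ := (t.map F).sum

/-! ### KMS states of a one-parameter group of automorphisms of a unital C*-algebra -/

section KMS

variable {A : Type*} [CStarAlgebra A]

/-- A state: a positive linear functional of value one at the unit. -/
def IsState (ω : A →ₗ[ℂ] ℂ) : Prop :=
  (∀ a : A, 0 ≤ (ω (star a * a)).re ∧ (ω (star a * a)).im = 0) ∧ ω 1 = 1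

/-- `f` is the entire extension of the orbit map `t ↦ α t a`; it is unique when it exists, and
`α z a = f z`. The element `a` is (entire) analytic for `α` when it exists. -/
def IsEntireExtension (α : ℝ → A ≃⋆ₐ[ℂ] A) (a : A) (f : ℂ → A) : Prop :=
  Differentiable ℂ f ∧ ∀ t : ℝ, f (t : ℂ) = α t a

/-- `ω` is a `β`-KMS state for `α`: it is a state, and `ω (a b) = ω (b (α (iβ) a))` for all `a, b`
in some dense `α`-invariant *-subalgebra consisting of analytic elements. -/
def IsKMSState (α : ℝ → A ≃⋆ₐ[ℂ] A) (β : ℝ) (ω : A →ₗ[ℂ] ℂ) : Prop :=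
  IsState ω ∧ ∃ D : NonUnitalStarSubalgebra ℂ A,
    Dense (D : Set A) ∧ (∀ t : ℝ, ∀ a ∈ D, α t a ∈ D) ∧
    ∀ a ∈ D, ∃ f : ℂ → A, IsEntireExtension α a f ∧
      ∀ b ∈ D, ω (a * b) = ω (b * f (Complex.I * β))

end KMS

/-! ### The Cuntz algebra over the alphabet `S`

It is realized on the Hilbert space with orthonormal basis `e (x, k)`, where `x` is an infinite word
and `k : S → ℤ`, by the isometries `V s : e (x, k) ↦ e (s x, k + 1_s)`. Their range projections
add up to `1`, so, when `S` has at least two elements, the C*-algebra generated by them is the Cuntz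
algebra. The second coordinate makes the action given by a potential `F` spatial, and makes the
canonical conditional expectation onto the continuous functions on the space of infinite words the
passage to the diagonal matrix coefficients. -/

section Cuntz

/-- The index set of the orthonormal basis. -/
abbrev Idx (S : Type*) : Type _ := PathSpace S × (S → ℤ)

/-- The Hilbert space. -/
abbrev Hilb (S : Type*) : Type _ := lp (fun _ : Idx S => ℂ) 2

/-- The bounded operators on the Hilbert space. -/
abbrev BH (S : Type*) : Type _ := Hilb S →L[ℂ] Hilb S

variable {S : Type*}

/-- The canonical orthonormal basis. -/
def bas (i : Idx S) : Hilb S := lp.single 2 i (1 : ℂ)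

theorem inner_bas (i : Idx S) (f : Hilb S) : inner ℂ (bas i) f = f i := by
  simp [bas, lp.inner_single_left]

theorem bas_apply (i j : Idx S) : bas i j = if j = i then (1 : ℂ) else 0 := by
  simp [bas, lp.single_apply, Pi.single_apply]

theorem orthonormal_bas : Orthonormal ℂ (bas : Idx S → Hilb S) := by
  rw [orthonormal_iff_ite]
  intro i j
  rw [inner_bas, bas_apply]

theorem ext_bas {T T' : BH S} (h : ∀ i, T (bas i) = T' (bas i)) : T = T' := by
  ext1 f
  have hf := lp.hasSum_single (E := fun _ : Idx S => ℂ) (p := 2) (by norm_num) f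
  have key : ∀ i, T (lp.single 2 i (f i)) = T' (lp.single 2 i (f i)) := by
    intro i
    have : (lp.single 2 i (f i) : Hilb S) = f i • bas i := by
      rw [bas, ← lp.single_smul]; simp
    rw [this, map_smul, map_smul, h]
  have h1 := hf.mapL T
  have h2 := hf.mapL T'
  simp only [key] at h1
  exact h1.unique h2

/-- The isometry which takes the canonical basis to a given orthonormal family. -/
def isom (v : Idx S → Hilb S) (hv : Orthonormal ℂ v) : BH S :=
  hv.orthogonalFamily.linearIsometry.toContinuousLinearMap

theorem isom_bas (v : Idx S → Hilb S) (hv : Orthonormal ℂ v) (i : Idx S) :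
    isom v hv (bas i) = v i := by
  simp [isom, bas]

theorem star_isom_mul_isom (v w : Idx S → Hilb S) (hv : Orthonormal ℂ v)
    (hw : Orthonormal ℂ w) (i j : Idx S) :
    (star (isom v hv) * isom w hw) (bas i) j = inner ℂ (v j) (w i) := by
  rw [← inner_bas, mul_apply_eq_comp, ContinuousLinearMap.star_eq_adjoint,
    ContinuousLinearMap.adjoint_inner_right, isom_bas, isom_bas]

theorem cons_injective {s r : S} {x y : PathSpace S}
    (h : PathSpace.cons s x = PathSpace.cons r y) : s = r ∧ x = y :=
  ⟨congrFun h 0, funext fun n => congrFun h (n + 1)⟩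

/-- The injection of the index set which defines `V s`. -/
def shiftIdx (s : S) (i : Idx S) : Idx S := (PathSpace.cons s i.1, i.2 + Pi.single s 1)

theorem shiftIdx_eq_iff {s r : S} {i j : Idx S} :
    shiftIdx s i = shiftIdx r j ↔ s = r ∧ i = j := by
  constructor
  · intro h
    obtain ⟨rfl, hx⟩ := cons_injective (congrArg Prod.fst h)
    exact ⟨rfl, Prod.ext hx (add_right_cancel (congrArg Prod.snd h))⟩
  · rintro ⟨rfl, rfl⟩; rfl

theorem orthonormal_shift (s : S) : Orthonormal ℂ fun i : Idx S => bas (shiftIdx s i) :=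
  orthonormal_bas.comp _ fun _ _ h => (shiftIdx_eq_iff.1 h).2

/-- The canonical isometry `V s`. -/
def V (s : S) : BH S := isom _ (orthonormal_shift s)

theorem V_bas (s : S) (i : Idx S) : V s (bas i) = bas (shiftIdx s i) := isom_bas _ _ i

theorem star_V_mul_V (s r : S) : star (V s) * V r = if s = r then 1 else 0 := by
  apply ext_bas
  intro i
  ext j
  rw [V, V, star_isom_mul_isom, inner_bas, bas_apply]
  split_ifs with h1 h2 h2
  · simp [(shiftIdx_eq_iff.1 h1).2, bas_apply]
  · exact absurd (shiftIdx_eq_iff.1 h1).1 h2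
  · subst h2
    have : j ≠ i := fun h => h1 (by rw [h])
    simp [bas_apply, this]
  · simp

theorem star_V_bas (s : S) (x : PathSpace S) (k : S → ℤ) :
    star (V s) (bas (x, k)) =
      if s = x 0 then bas (PathSpace.tail x, k - Pi.single s 1) else 0 := by
  have hi : ((x, k) : Idx S) = shiftIdx (x 0) (PathSpace.tail x, k - Pi.single (x 0) 1) := by
    refine Prod.ext ?_ (by simp [shiftIdx])
    funext n
    cases n <;> rfl
  rw [hi, ← V_bas, ← mul_apply_eq_comp, star_V_mul_V]
  split_ifs with h
  · subst h; rfl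
  · rfl

theorem sum_V_mul_star_V [Fintype S] : ∑ s : S, V s * star (V s) = 1 := by
  apply ext_bas
  rintro ⟨x, k⟩
  have hs : ∀ s : S, (V s * star (V s)) (bas (x, k)) = if s = x 0 then bas (x, k) else 0 := by
    intro s
    rw [mul_apply_eq_comp, star_V_bas]
    split_ifs with h
    · subst h
      rw [V_bas]
      congr 1
      refine Prod.ext ?_ (by simp [shiftIdx])
      funext n
      cases n <;> rfl
    · simp
  simp [hs]

/-- `V t` for a finite word `t`. -/
def VW (t : List S) : BH S := (t.map V).prod

theorem VW_append (t u : List S) : VW (t ++ u) = VW t * VW u := by simp [VW]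

theorem VW_cons (s : S) (u : List S) : VW (s :: u) = V s * VW u := by simp [VW]

theorem VW_nil : VW ([] : List S) = 1 := rfl

theorem star_VW_mul_VW (u t : List S) :
    (∃ x, t = u ++ x ∧ star (VW u) * VW t = VW x) ∨
      (∃ x, u = t ++ x ∧ star (VW u) * VW t = star (VW x)) ∨ star (VW u) * VW t = 0 := by
  induction u generalizing t with
  | nil => exact Or.inl ⟨t, rfl, by simp [VW_nil]⟩
  | cons s u ih =>
    cases t with
    | nil => exact Or.inr (Or.inl ⟨s :: u, rfl, by simp [VW_nil]⟩)
    | cons r t =>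
      have h : star (VW (s :: u)) * VW (r :: t) =
          star (VW u) * (star (V s) * V r) * VW t := by
        rw [VW_cons, VW_cons, star_mul]; simp only [mul_assoc]
      rw [h, star_V_mul_V]
      by_cases hsr : s = r
      · subst hsr
        simp only [if_true, mul_one]
        rcases ih t with ⟨x, rfl, hx⟩ | ⟨x, rfl, hx⟩ | hx
        · exact Or.inl ⟨x, rfl, hx⟩
        · exact Or.inr (Or.inl ⟨x, rfl, hx⟩)
        · exact Or.inr (Or.inr hx)
      · exact Or.inr (Or.inr (by simp [hsr]))

/-- The canonical conditional expectation `E` onto the continuous functions on the space of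
infinite words: `E (V t (V u)*)` is the indicator function of the cylinder of `t` if `t = u`, and
it is zero otherwise; see `expectation_VW`. -/
def expectation (a : BH S) (x : PathSpace S) : ℂ := inner ℂ (bas (x, 0)) (a (bas (x, 0)))

theorem mem_cylinder_cons (s : S) (t : List S) (x : PathSpace S) :
    x ∈ cylinder (s :: t) ↔ s = x 0 ∧ PathSpace.tail x ∈ cylinder t := by
  simp only [cylinder, Set.mem_ofPred_eq, List.length_cons, Fin.forall_fin_succ]
  constructor
  · rintro ⟨h1, h2⟩; exact ⟨h1.symm, h2⟩
  · rintro ⟨h1, h2⟩; exact ⟨h1.symm, h2⟩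

theorem star_VW_bas (u : List S) (x : PathSpace S) (k : S → ℤ) :
    star (VW u) (bas (x, k)) =
      if x ∈ cylinder u then
        bas (PathSpace.tail^[u.length] x, k - (u.map fun s => (Pi.single s 1 : S → ℤ)).sum)
      else 0 := by
  induction u generalizing x k with
  | nil => simp [VW_nil, cylinder]
  | cons s u ih =>
    rw [VW_cons, star_mul, mul_apply_eq_comp, star_V_bas]
    by_cases h : s = x 0
    · simp [mem_cylinder_cons, h, ih, sub_sub]
    · simp [mem_cylinder_cons, h]

theorem expectation_VW [Fintype S] (t u : List S) (x : PathSpace S) :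
    expectation (VW t * star (VW u)) x = if t = u ∧ x ∈ cylinder t then 1 else 0 := by
  have hl : ∀ w : List S, ∑ r, (w.map fun s => (Pi.single s 1 : S → ℤ)).sum r = w.length := by
    intro w
    induction w with
    | nil => simp
    | cons s w ih =>
      simp only [List.map_cons, List.sum_cons, Pi.add_apply, Finset.sum_add_distrib, ih]
      simp [Pi.single_apply, add_comm]
  have h0 : expectation (VW t * star (VW u)) x =
      inner ℂ (star (VW t) (bas (x, 0))) (star (VW u) (bas (x, 0))) := by
    rw [expectation, mul_apply_eq_comp, ContinuousLinearMap.star_eq_adjoint (VW t),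
      ContinuousLinearMap.adjoint_inner_left]
  rw [h0, star_VW_bas, star_VW_bas]
  by_cases ht : x ∈ cylinder t
  · by_cases hu : x ∈ cylinder u
    · rw [if_pos ht, if_pos hu, inner_bas, bas_apply]
      by_cases htu : t = u
      · simp [htu, hu]
      · rw [if_neg, if_neg (fun h => htu h.1)]
        intro h
        have h2 := congrArg Prod.snd h
        simp only [zero_sub, neg_inj] at h2
        have h3 : t.length = u.length := by
          have h4 := hl t
          rw [h2, hl u] at h4
          exact_mod_cast h4.symm
        apply htu
        refine List.ext_get h3 fun n h5 h6 => ?_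
        exact (ht ⟨n, h5⟩).symm.trans (hu ⟨n, h6⟩)
    · have : t ≠ u := by rintro rfl; exact hu ht
      simp [hu, this]
  · simp [ht]

/-! ### The action of the real line given by a potential -/

variable [Fintype S]

/-- The eigenvalue of `U F t` at the basis vector with index `i`. -/
def phase (F : S → ℝ) (t : ℝ) (i : Idx S) : ℂ :=
  Complex.exp (Complex.I * ((t * ∑ s, F s * (i.2 s : ℝ) : ℝ) : ℂ))

theorem phase_norm (F : S → ℝ) (t : ℝ) (i : Idx S) : ‖phase F t i‖ = 1 := by
  rw [phase, mul_comm, Complex.norm_exp_ofReal_mul_I]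

theorem phase_add (F : S → ℝ) (t r : ℝ) (i : Idx S) :
    phase F (t + r) i = phase F t i * phase F r i := by
  rw [phase, phase, phase, ← Complex.exp_add]
  congr 1; push_cast; ring

theorem phase_shiftIdx (F : S → ℝ) (t : ℝ) (s : S) (i : Idx S) :
    phase F t (shiftIdx s i) = Complex.exp (Complex.I * ((t * F s : ℝ) : ℂ)) * phase F t i := by
  have h : ∑ r, F r * ((shiftIdx s i).2 r : ℝ) = F s + ∑ r, F r * (i.2 r : ℝ) := by
    simp [shiftIdx, mul_add, Finset.sum_add_distrib, Pi.single_apply, add_comm]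
  rw [phase, phase, ← Complex.exp_add, h]
  congr 1; push_cast; ring

theorem orthonormal_phase (F : S → ℝ) (t : ℝ) :
    Orthonormal ℂ fun i : Idx S => phase F t i • bas i := by
  rw [orthonormal_iff_ite]
  intro i j
  rw [inner_smul_left, inner_smul_right, inner_bas, bas_apply]
  split_ifs with h
  · subst h
    rw [mul_one, Complex.conj_mul', phase_norm]; simp
  · simp

/-- The diagonal unitary which multiplies `e (x, k)` by `exp (i t ∑ s, F s * k s)`. -/
def U (F : S → ℝ) (t : ℝ) : BH S := isom _ (orthonormal_phase F t)

theorem U_bas (F : S → ℝ) (t : ℝ) (i : Idx S) : U F t (bas i) = phase F t i • bas i :=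
  isom_bas _ _ i

theorem U_add (F : S → ℝ) (t r : ℝ) : U F (t + r) = U F t * U F r := by
  apply ext_bas
  intro i
  rw [mul_apply_eq_comp, U_bas, U_bas, map_smul, U_bas, phase_add, smul_smul, mul_comm]

theorem U_zero (F : S → ℝ) : U F 0 = 1 := by
  apply ext_bas
  intro i
  simp [U_bas, phase]

theorem star_U_mul_U (F : S → ℝ) (t : ℝ) : star (U F t) * U F t = 1 := by
  apply ext_bas
  intro i
  ext j
  have h := (orthonormal_iff_ite.1 (orthonormal_phase F t)) j i
  rw [U, star_isom_mul_isom, h, one_apply_eq_self, bas_apply]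
  congr

theorem star_U (F : S → ℝ) (t : ℝ) : star (U F t) = U F (-t) := by
  have h : U F t * U F (-t) = 1 := by rw [← U_add, add_neg_cancel, U_zero]
  calc star (U F t) = star (U F t) * (U F t * U F (-t)) := by rw [h, mul_one]
    _ = U F (-t) := by rw [← mul_assoc, star_U_mul_U, one_mul]

/-- `U F t` as a unitary. -/
def unitaryU (F : S → ℝ) (t : ℝ) : unitary (BH S) :=
  ⟨U F t, star_U_mul_U F t, by rw [star_U, ← U_add, add_neg_cancel, U_zero]⟩

/-- The automorphism `a ↦ U a U*`, which takes `V s` to `exp (i t F s) V s`. -/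
def conjU (F : S → ℝ) (t : ℝ) : BH S ≃⋆ₐ[ℂ] BH S :=
  Unitary.conjStarAlgAut ℂ (BH S) (unitaryU F t)

theorem conjU_apply (F : S → ℝ) (t : ℝ) (a : BH S) : conjU F t a = U F t * a * U F (-t) := by
  rw [conjU, Unitary.conjStarAlgAut_apply, ← star_U]; rfl

theorem conjU_conjU_neg (F : S → ℝ) (t : ℝ) (a : BH S) : conjU F t (conjU F (-t) a) = a := by
  have h : U F t * U F (-t) = 1 := by rw [← U_add, add_neg_cancel, U_zero]
  rw [conjU_apply, conjU_apply, neg_neg]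
  calc U F t * (U F (-t) * a * U F t) * U F (-t)
      = (U F t * U F (-t)) * a * (U F t * U F (-t)) := by simp only [mul_assoc]
    _ = a := by rw [h, one_mul, mul_one]

theorem conjU_V (F : S → ℝ) (t : ℝ) (s : S) :
    conjU F t (V s) = Complex.exp (Complex.I * ((t * F s : ℝ) : ℂ)) • V s := by
  have h1 : U F t * V s = Complex.exp (Complex.I * ((t * F s : ℝ) : ℂ)) • (V s * U F t) := by
    apply ext_bas
    intro i
    simp only [mul_apply_eq_comp, smul_apply, V_bas, U_bas, map_smul,
      phase_shiftIdx, smul_smul]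
  rw [conjU_apply, h1, smul_mul_assoc, mul_assoc, ← U_add, add_neg_cancel, U_zero, mul_one]

theorem conjU_VW (F : S → ℝ) (t : ℝ) (w : List S) :
    conjU F t (VW w) = Complex.exp (Complex.I * ((t * potential F w : ℝ) : ℂ)) • VW w := by
  induction w with
  | nil => simp [VW_nil, potential]
  | cons s w ih =>
    rw [VW_cons, map_mul, conjU_V, ih, smul_mul_smul_comm, ← Complex.exp_add]
    congr 2
    simp [potential]; ring

theorem conjU_VW_star (F : S → ℝ) (t : ℝ) (w u : List S) :
    conjU F t (VW w * star (VW u)) =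
      Complex.exp (Complex.I * ((t * (potential F w - potential F u) : ℝ) : ℂ)) •
        (VW w * star (VW u)) := by
  rw [map_mul, map_star, conjU_VW, conjU_VW, star_smul, smul_mul_smul_comm]
  congr 1
  rw [Complex.star_def, ← Complex.exp_conj, ← Complex.exp_add]
  congr 1
  simp; ring

end Cuntz

/-! ### The C*-algebra of the pointed Cayley graph, and its KMS measures -/

section Corner

variable {G : Type*} [Group G] {Y : Finset G}

/-- The value in `G` of a finite word in the generators. -/
def wordProd (t : List Y) : G := (t.map Subtype.val).prod

theorem wordProd_append (t u : List Y) : wordProd (t ++ u) = wordProd t * wordProd u := by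
  simp [wordProd]

/-- The elements `V t (V u)*` where the words `t` and `u` have the same value in `G`. -/
def cornerGen (Y : Finset G) : Set (BH Y) :=
  {a | ∃ t u : List Y, wordProd t = wordProd u ∧ a = VW t * star (VW u)}

theorem cornerGen_mul {a b : BH Y} (ha : a ∈ cornerGen Y) (hb : b ∈ cornerGen Y) :
    a * b ∈ Submodule.span ℂ (cornerGen Y) := by
  obtain ⟨t₁, u₁, h₁, rfl⟩ := ha
  obtain ⟨t₂, u₂, h₂, rfl⟩ := hb
  have h : VW t₁ * star (VW u₁) * (VW t₂ * star (VW u₂)) =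
      VW t₁ * (star (VW u₁) * VW t₂) * star (VW u₂) := by simp only [mul_assoc]
  rw [h]
  rcases star_VW_mul_VW u₁ t₂ with ⟨x, rfl, hx⟩ | ⟨x, rfl, hx⟩ | hx
  · refine Submodule.subset_span ⟨t₁ ++ x, u₂, ?_, by rw [hx, VW_append]⟩
    rw [wordProd_append, h₁, ← wordProd_append, h₂]
  · refine Submodule.subset_span ⟨t₁, u₂ ++ x, ?_, ?_⟩
    · rw [h₁, wordProd_append, h₂, ← wordProd_append]
    · rw [hx, VW_append, star_mul, mul_assoc]
  · rw [hx]; simp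

/-- The linear span of the elements `V t (V u)*` where `t` and `u` have the same value in `G`; it is
a *-algebra. -/
def cornerSpan (Y : Finset G) : StarSubalgebra ℂ (BH Y) where
  carrier := Submodule.span ℂ (cornerGen Y)
  mul_mem' {a b} ha hb := by
    induction ha, hb using Submodule.span_induction₂ with
    | mem_mem a b ha hb => exact cornerGen_mul ha hb
    | zero_left b hb => simp
    | zero_right a ha => simp
    | add_left a a' b _ _ _ h h' => rw [add_mul]; exact add_mem h h'
    | add_right a b b' _ _ _ h h' => rw [mul_add]; exact add_mem h h'
    | smul_left c a b _ _ h => rw [smul_mul_assoc]; exact Submodule.smul_mem _ c h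
    | smul_right c a b _ _ h => rw [mul_smul_comm]; exact Submodule.smul_mem _ c h
  add_mem' ha hb := add_mem ha hb
  algebraMap_mem' c := by
    rw [Algebra.algebraMap_eq_smul_one]
    exact Submodule.smul_mem _ c (Submodule.subset_span ⟨[], [], rfl, by simp [VW_nil]⟩)
  star_mem' {a} ha := by
    induction ha using Submodule.span_induction with
    | mem a ha =>
      obtain ⟨t, u, h, rfl⟩ := ha
      exact Submodule.subset_span ⟨u, t, h.symm, by simp⟩
    | zero => simp
    | add a b _ _ h h' => rw [star_add]; exact add_mem h h'
    | smul c a _ h => rw [star_smul]; exact Submodule.smul_mem _ _ h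

/-- The closed span of the elements `V t (V u)*` where `t` and `u` have the same value in `G`. It is a
copy of the corner, given by the vertex projection of the neutral element, of the graph
C*-algebra of the Cayley graph of `G` with respect to `Y`. -/
def corner (Y : Finset G) : StarSubalgebra ℂ (BH Y) := (cornerSpan Y).topologicalClosure

instance (Y : Finset G) : IsClosed (corner Y : Set (BH Y)) :=
  (cornerSpan Y).isClosed_topologicalClosure

theorem conjU_mem_cornerSpan (F : Y → ℝ) (t : ℝ) {a : BH Y} (ha : a ∈ cornerSpan Y) :
    conjU F t a ∈ cornerSpan Y := by
  change a ∈ Submodule.span ℂ (cornerGen Y) at ha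
  change conjU F t a ∈ Submodule.span ℂ (cornerGen Y)
  induction ha using Submodule.span_induction with
  | mem a ha =>
    obtain ⟨w, u, h, rfl⟩ := ha
    rw [conjU_VW_star]
    exact Submodule.smul_mem _ _ (Submodule.subset_span ⟨w, u, h, rfl⟩)
  | zero => simp
  | add a b _ _ h h' => rw [map_add]; exact add_mem h h'
  | smul c a _ h => rw [map_smul]; exact Submodule.smul_mem _ _ h

theorem conjU_mem_corner (F : Y → ℝ) (t : ℝ) {a : BH Y} (ha : a ∈ corner Y) :
    conjU F t a ∈ corner Y := by
  have hc : Continuous (conjU F t : BH Y → BH Y) := by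
    have : (conjU F t : BH Y → BH Y) = fun a => U F t * a * U F (-t) :=
      funext fun a => conjU_apply F t a
    rw [this]; fun_prop
  exact map_mem_closure hc ha fun b hb => conjU_mem_cornerSpan F t hb

/-- The one-parameter group of automorphisms
`V w (V u)* ↦ exp (i t (F w - F u)) V w (V u)*`. -/
def action (F : Y → ℝ) (t : ℝ) : corner Y ≃⋆ₐ[ℂ] corner Y where
  toFun a := ⟨conjU F t a, conjU_mem_corner F t a.2⟩
  invFun a := ⟨conjU F (-t) a, conjU_mem_corner F (-t) a.2⟩
  left_inv a := Subtype.ext (by simpa using conjU_conjU_neg F (-t) (a : BH Y))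
  right_inv a := Subtype.ext (conjU_conjU_neg F t (a : BH Y))
  map_mul' a b := Subtype.ext (by simp)
  map_add' a b := Subtype.ext (by simp)
  map_star' a := Subtype.ext (by simp [map_star])
  map_smul' c a := Subtype.ext (by simp)

/-- `m` is a `β`-KMS measure for the action defined by `F`: the functional `a ↦ ∫ E(a) dm` is a
`β`-KMS state. -/
def IsKMSMeasure (F : Y → ℝ) (β : ℝ) (m : ProbabilityMeasure (PathSpace Y)) : Prop :=
  ∃ ω : corner Y →ₗ[ℂ] ℂ,
    (∀ a : corner Y, ω a = ∫ x, expectation (a : BH Y) x ∂(m : Measure (PathSpace Y))) ∧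
      IsKMSState (action F) β ω

end Corner

end CayleyKMS

end

/-! A KMS measure m is encoded by a function on G. If t and u have the same value in G, the KMS
condition at V_t V_u^* compares the expectations of V_t V_t^* and V_u V_u^*, so e^{βF(t)} m(tY^ℕ)
depends only on the value of t in G (`IsKMSMeasure.measureReal_cylinder`). This defines ψ ≥ 0 on G
with ψ(1) = 1, and additivity of m gives the harmonicity equation ψ(g) = ∑ e^{-βF(s)} ψ(gs)
(`IsKMSMeasure.exists_harmonic`).

If ψ has finitely many values, a maximum principle settles everything (`harmonic_of_finite_range`):
the maximum forces ∑ e^{-βF(s)} ≥ 1, the minimum, which cannot be 0, forces ≤ 1, and then the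
maximum spreads to all of G. So ψ = 1, that is, m is Bernoulli. Finiteness of the range has two
sources. For abelian m, ψ factors through the finite abelianization (`eq_of_abelianization_eq`). For
nilpotent G, a finite abelianization makes G itself finite, by Schur's theorem and induction on
central quotients.

Conversely, when the weights add up to 1 the Bernoulli measure exists, and the KMS condition is
checked on the span of the V_t V_u^* by moving one generator at a time around the product.

The definition of a KMS state provides the condition only on some dense subalgebra, which need not
contain V_t V_u^*. `IsKMSState.apply_mul_of_eigenvector` transfers it to all eigenvectors of the
action, by a contour integral over long rectangles in the strip between ℝ and ℝ + iβ. -/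

noncomputable section

namespace CayleyKMS

open scoped Classical commutatorElement

/-! ### Groups -/

/-- Schur: a group whose center has finite index has finitely many commutators. -/
theorem finite_commutatorSet_of_finite_quotient_center (G : Type*) [Group G]
    [Finite (G ⧸ Subgroup.center G)] : Finite (commutatorSet G) := by
  let f : (G ⧸ Subgroup.center G) × (G ⧸ Subgroup.center G) → G := fun p => ⁅p.1.out, p.2.out⁆
  refine ((Set.finite_range f).subset ?_).to_subtype
  rintro _ ⟨a, b, rfl⟩
  obtain ⟨z, hz⟩ := QuotientGroup.mk_out_eq_mul (Subgroup.center G) a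
  obtain ⟨w, hw⟩ := QuotientGroup.mk_out_eq_mul (Subgroup.center G) b
  have hz' := fun g => Subgroup.mem_center_iff.1 z.2 g
  have hw' := fun g => Subgroup.mem_center_iff.1 w.2 g
  -- The chosen representatives differ from a and b by central factors, which cancel in the
  -- commutator.
  refine ⟨(a, b), ?_⟩
  simp only [f, hz, hw, commutatorElement_def, mul_inv_rev]
  have e1 : a * (z : G) * (b * w) = a * b * w * z := by
    rw [hz' a, mul_assoc, ← hz' (a * (b * w))]
    simp only [mul_assoc]
  have e2 : ((z : G)⁻¹ * a⁻¹) * ((w : G)⁻¹ * b⁻¹) = (z : G)⁻¹ * (w : G)⁻¹ * (a⁻¹ * b⁻¹) := by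
    have h : a⁻¹ * (w : G)⁻¹ = (w : G)⁻¹ * a⁻¹ := by
      rw [← mul_inv_rev, ← mul_inv_rev, hw' a]
    rw [mul_assoc, ← mul_assoc a⁻¹, h]
    simp only [mul_assoc]
  rw [mul_assoc (a * z * (b * w)), e1, e2]
  group

/-- A nilpotent group with finite abelianization is finite. -/
theorem finite_of_isNilpotent_of_finite_abelianization (G : Type*) [Group G]
    [Group.IsNilpotent G] (h : Finite (Abelianization G)) : Finite G := by
  revert h
  refine Group.nilpotent_center_quotient_ind
    (P := fun G _ _ => Finite (Abelianization G) → Finite G) G ?_ ?_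
  · intro G _ _ _
    infer_instance
  · intro G _ _ ih h
    -- The abelianization of G/Z(G) is a quotient of that of G, hence finite, so the induction
    -- hypothesis applies to G/Z(G).
    have hs : Function.Surjective (Abelianization.map (QuotientGroup.mk' (Subgroup.center G))) := by
      intro x
      obtain ⟨y, rfl⟩ := QuotientGroup.mk_surjective x
      obtain ⟨g, rfl⟩ := QuotientGroup.mk_surjective y
      exact ⟨Abelianization.of g, rfl⟩
    have := ih (Finite.of_surjective _ hs)
    -- Finitely many commutators generate a finite commutator subgroup (Schur), and the quotient by
    -- it is finite by assumption.
    have := finite_commutatorSet_of_finite_quotient_center G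
    have : Finite (G ⧸ commutator G) := h
    exact Finite.of_subgroup_quotient (commutator G)

theorem wordProd_surjective {G : Type*} [Group G] {Y : Finset G}
    (hgen : Subsemigroup.closure (Y : Set G) = ⊤) (g : G) :
    ∃ t : List Y, wordProd t = g := by
  induction g using Subsemigroup.dense_induction (Y : Set G) hgen with
  | mem s hs => exact ⟨[⟨s, hs⟩], by simp [wordProd]⟩
  | mul x y hx hy =>
    obtain ⟨t, rfl⟩ := hx
    obtain ⟨u, rfl⟩ := hy
    exact ⟨t ++ u, wordProd_append t u⟩

/-- A function on a group for which any two arguments after the first may be interchanged is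
constant on the fibres of the abelianization. -/
theorem eq_of_abelianization_eq {G X : Type*} [Group G] (ψ : G → X)
    (h : ∀ a b c, ψ (a * b * c) = ψ (a * c * b)) {a b : G}
    (hab : Abelianization.of a = Abelianization.of b) : ψ a = ψ b := by
  -- The right periods of ψ form a subgroup; it suffices that it contains every commutator.
  let H : Subgroup G :=
    { carrier := {c | ∀ g, ψ (g * c) = ψ g}
      mul_mem' := fun {x y} hx hy g => by rw [← mul_assoc, hy, hx]
      one_mem' := fun g => by rw [mul_one]
      inv_mem' := fun {x} hx g => by
        have := hx (g * x⁻¹)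
        rw [inv_mul_cancel_right] at this
        exact this.symm }
  have hH : commutator G ≤ H := by
    rw [commutator_def, Subgroup.commutator_le]
    intro x _ y _ g
    have h1 : g * ⁅x, y⁆ = g * x * y * x⁻¹ * y⁻¹ := by rw [commutatorElement_def]; group
    -- Interchanging x⁻¹ and y⁻¹ leaves g x y y⁻¹ x⁻¹ = g.
    rw [h1, h]
    congr 1
    group
  have hm : a⁻¹ * b ∈ commutator G := QuotientGroup.eq.1 hab
  have := hH hm a
  rw [mul_inv_cancel_left] at this
  exact this.symm

/-! ### Harmonic functions with finitely many values -/

/-- A non-negative function on a group, with finitely many values, which is harmonic for positive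
weights on a generating set, forces the weights to add up to one, and is constant. -/
theorem harmonic_of_finite_range {G : Type*} [Group G] {Y : Finset G}
    (hgen : Subsemigroup.closure (Y : Set G) = ⊤) (w : Y → ℝ) (hw : ∀ s, 0 < w s)
    (ψ : G → ℝ) (hψ : ∀ g, 0 ≤ ψ g) (hfin : (Set.range ψ).Finite) (h1 : ψ 1 = 1)
    (hh : ∀ g, ψ g = ∑ s : Y, w s * ψ (g * s)) : ∑ s : Y, w s = 1 ∧ ∀ g, ψ g = 1 := by
  -- A nonempty level set stable under right multiplication by Y is all of G, since Y generates G as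
  -- a semigroup.
  have prop : ∀ c : ℝ, (∀ g, ψ g = c → ∀ s : Y, ψ (g * s) = c) → ∀ g, ψ g = c → ∀ k, ψ k = c := by
    intro c hc g hg k
    have key : ∀ x : G, ∀ g, ψ g = c → ψ (g * x) = c := by
      intro x
      induction x using Subsemigroup.dense_induction (Y : Set G) hgen with
      | mem s hs => exact fun g hg => hc g hg ⟨s, hs⟩
      | mul x y hx hy =>
        intro g hg
        rw [← mul_assoc]
        exact hy _ (hx _ hg)
    simpa using key (g⁻¹ * k) g hg
  obtain ⟨_, ⟨a, rfl⟩, ha⟩ :=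
    Set.exists_max_image (Set.range ψ) id hfin ⟨ψ 1, Set.mem_range_self _⟩
  obtain ⟨_, ⟨b, rfl⟩, hb⟩ :=
    Set.exists_min_image (Set.range ψ) id hfin ⟨ψ 1, Set.mem_range_self _⟩
  have ha : ∀ g, ψ g ≤ ψ a := fun g => ha _ ⟨g, rfl⟩
  have hb : ∀ g, ψ b ≤ ψ g := fun g => hb _ ⟨g, rfl⟩
  have hapos : 0 < ψ a := lt_of_lt_of_le (by norm_num) (h1 ▸ ha 1)
  have hge : 1 ≤ ∑ s : Y, w s := by
    have : 1 * ψ a ≤ (∑ s : Y, w s) * ψ a := by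
      rw [one_mul, Finset.sum_mul]
      exact (hh a).le.trans (Finset.sum_le_sum fun s _ =>
        mul_le_mul_of_nonneg_left (ha _) (hw s).le)
    exact le_of_mul_le_mul_right this hapos
  -- A zero of ψ would spread to its neighbours, because the weights are positive, and finally to 1,
  -- where ψ = 1.
  have hbpos : 0 < ψ b := by
    refine lt_of_le_of_ne (hψ b) fun h0 => ?_
    have := prop 0 (fun g hg s => ?_) b h0.symm 1
    · rw [h1] at this; exact one_ne_zero this
    · have h2 := hh g
      rw [hg] at h2
      have h3 := (Finset.sum_eq_zero_iff_of_nonneg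
        fun s _ => mul_nonneg (hw s).le (hψ (g * s))).1 h2.symm s (Finset.mem_univ s)
      exact (mul_eq_zero.1 h3).resolve_left (hw s).ne'
  have hle : ∑ s : Y, w s ≤ 1 := by
    have : (∑ s : Y, w s) * ψ b ≤ 1 * ψ b := by
      rw [one_mul, Finset.sum_mul]
      exact (Finset.sum_le_sum fun s _ =>
        mul_le_mul_of_nonneg_left (hb _) (hw s).le).trans (hh b).ge
    exact le_of_mul_le_mul_right this hbpos
  have hsum := le_antisymm hle hge
  refine ⟨hsum, ?_⟩
  have hconst : ∀ k, ψ k = ψ a := by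
    refine prop (ψ a) (fun g hg s => ?_) a rfl
    -- At a maximum point the weighted average of non-negative defects vanishes, so each defect
    -- does.
    have h2 : ∑ s : Y, w s * (ψ a - ψ (g * s)) = 0 := by
      simp only [mul_sub, Finset.sum_sub_distrib]
      rw [← Finset.sum_mul, hsum, one_mul, ← hh g, hg, sub_self]
    have h3 := (Finset.sum_eq_zero_iff_of_nonneg
      fun s _ => mul_nonneg (hw s).le (sub_nonneg.2 (ha (g * s)))).1 h2 s (Finset.mem_univ s)
    exact (sub_eq_zero.1 ((mul_eq_zero.1 h3).resolve_left (hw s).ne')).symm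
  intro g
  rw [hconst g, ← hconst 1, h1]

/-! ### Measures on the space of infinite words -/

section Measures

variable {S : Type*}

theorem isOpen_cylinder (t : List S) : IsOpen (cylinder t) := by
  let _ : TopologicalSpace S := ⊥
  have : DiscreteTopology S := ⟨rfl⟩
  let e : ℕ → PathSpace S → S := fun n x => x n
  have h : cylinder t = ⋂ i : Fin t.length, e i ⁻¹' {t.get i} := by
    ext x
    simp [cylinder, e]
  rw [h]
  exact isOpen_iInter_of_finite fun i =>
    (isOpen_discrete {t.get i}).preimage (continuous_apply (A := fun _ : ℕ => S) (i : ℕ))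

theorem measurableSet_cylinder (t : List S) : MeasurableSet (cylinder t) :=
  (isOpen_cylinder t).measurableSet

theorem cylinder_nil : cylinder ([] : List S) = Set.univ :=
  Set.eq_univ_of_forall fun _ i => i.elim0

theorem mem_cylinder_append (t u : List S) (x : PathSpace S) :
    x ∈ cylinder (t ++ u) ↔ x ∈ cylinder t ∧ PathSpace.tail^[t.length] x ∈ cylinder u := by
  induction t generalizing x with
  | nil => simp [cylinder_nil]
  | cons s t ih => simp [mem_cylinder_cons, ih, and_assoc]

theorem mem_cylinder_singleton (s : S) (x : PathSpace S) : x ∈ cylinder [s] ↔ s = x 0 := by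
  simp [mem_cylinder_cons, cylinder_nil]

/-- The initial word of length `n`. -/
def prefixWord (x : PathSpace S) (n : ℕ) : List S := List.ofFn fun i : Fin n => x i

theorem mem_cylinder_prefixWord {x y : PathSpace S} {n : ℕ} :
    y ∈ cylinder (prefixWord x n) ↔ ∀ i < n, y i = x i := by
  simp only [cylinder, Set.mem_ofPred_eq, prefixWord]
  constructor
  · intro h i hi
    simpa using h ⟨i, by simpa using hi⟩
  · intro h i
    simpa using h i (by simpa using i.2)

theorem prefixWord_length {t : List S} {x : PathSpace S} (hx : x ∈ cylinder t) :
    prefixWord x t.length = t := by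
  refine List.ext_get (by simp [prefixWord]) fun n h1 h2 => ?_
  simpa [prefixWord] using hx ⟨n, h2⟩

/-- A common point x makes both words prefixes of x, so the intersection is the cylinder of the
longer prefix. -/
theorem isPiSystem_cylinder : IsPiSystem (Set.range (cylinder : List S → Set (PathSpace S))) := by
  rintro _ ⟨t, rfl⟩ _ ⟨u, rfl⟩ ⟨x, hxt, hxu⟩
  rw [← prefixWord_length hxt, ← prefixWord_length hxu]
  refine ⟨prefixWord x (max t.length u.length), ?_⟩
  ext y
  simp only [Set.mem_inter_iff, mem_cylinder_prefixWord, lt_max_iff]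
  exact ⟨fun h => ⟨fun i hi => h i (Or.inl hi), fun i hi => h i (Or.inr hi)⟩,
    fun h i hi => hi.elim (h.1 i) (h.2 i)⟩

theorem borel_eq_generateFrom_cylinder [Countable S] :
    borel (PathSpace S) =
      MeasurableSpace.generateFrom (Set.range (cylinder : List S → Set (PathSpace S))) := by
  let _ : TopologicalSpace S := ⊥
  have : DiscreteTopology S := ⟨rfl⟩
  have hb : TopologicalSpace.IsTopologicalBasis
      (Set.range (cylinder : List S → Set (PathSpace S))) := by
    refine TopologicalSpace.isTopologicalBasis_of_isOpen_of_nhds ?_ ?_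
    · rintro _ ⟨t, rfl⟩
      exact isOpen_cylinder t
    · intro x s hx hs
      obtain ⟨_, ⟨y, n, rfl⟩, hxy, hsub⟩ :=
        (PiNat.isTopologicalBasis_cylinders fun _ => S).exists_subset_of_mem_open hx hs
      refine ⟨_, ⟨prefixWord x n, rfl⟩, mem_cylinder_prefixWord.2 fun _ _ => rfl, ?_⟩
      refine subset_trans ?_ hsub
      intro z hz i hi
      exact (mem_cylinder_prefixWord.1 hz i hi).trans (hxy i hi)
  have : SecondCountableTopology (PathSpace S) :=
    inferInstanceAs (SecondCountableTopology (ℕ → S))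
  exact hb.borel_eq_generateFrom

theorem probabilityMeasure_ext [Countable S] {m m' : ProbabilityMeasure (PathSpace S)}
    (h : ∀ t : List S, (m : Measure (PathSpace S)) (cylinder t) =
      (m' : Measure (PathSpace S)) (cylinder t)) : m = m' := by
  apply Subtype.ext
  change (m : Measure (PathSpace S)) = m'
  refine ext_of_generate_finite (m0 := instMeasurableSpacePathSpace S) _
    borel_eq_generateFrom_cylinder isPiSystem_cylinder ?_ (by simp)
  rintro _ ⟨t, rfl⟩
  exact h t

theorem IsBernoulli.unique [Fintype S] {m m' : ProbabilityMeasure (PathSpace S)} {p : S → ℝ}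
    (h : IsBernoulli m p) (h' : IsBernoulli m' p) : m = m' :=
  probabilityMeasure_ext fun t => by rw [h.2.2, h'.2.2]

theorem IsBernoulli.isAbelianMeasure [Fintype S] {m : ProbabilityMeasure (PathSpace S)} {p : S → ℝ}
    (h : IsBernoulli m p) : IsAbelianMeasure m := by
  intro t₁ t₂ t₃
  rw [h.2.2, h.2.2]
  congr 1
  simp only [List.map_append, List.prod_append]
  ring

/-- The measure of a cylinder is the sum of the measures of the cylinders one letter longer. -/
theorem measureReal_cylinder_eq_sum [Fintype S] (m : ProbabilityMeasure (PathSpace S))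
    (t : List S) : (m : Measure (PathSpace S)).real (cylinder t) =
      ∑ s, (m : Measure (PathSpace S)).real (cylinder (t ++ [s])) := by
  have h : cylinder t = ⋃ s ∈ (Finset.univ : Finset S), cylinder (t ++ [s]) := by
    ext x
    simp [mem_cylinder_append, mem_cylinder_singleton]
  conv_lhs => rw [h]
  refine measureReal_biUnion_finset ?_ fun s _ => measurableSet_cylinder _
  intro s _ r _ hsr
  refine Set.disjoint_left.2 fun x hx hx' => hsr ?_
  rw [mem_cylinder_append, mem_cylinder_singleton] at hx hx'
  exact hx.2.trans hx'.2.symm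

/-- Existence of Bernoulli measures. -/
theorem exists_isBernoulli [Fintype S] (p : S → ℝ) (h0 : ∀ s, 0 ≤ p s) (h1 : ∑ s, p s = 1) :
    ∃ m : ProbabilityMeasure (PathSpace S), IsBernoulli m p := by
  let _ : MeasurableSpace S := ⊤
  let _ : TopologicalSpace S := ⊥
  have : DiscreteTopology S := ⟨rfl⟩
  have : BorelSpace S := ⟨borel_eq_top_of_discrete.symm⟩
  have hb : MeasurableSpace.pi = borel (ℕ → S) := BorelSpace.measurable_eq
  -- The identity map, used to carry the product σ-algebra over to the Borel one.
  let φ : (ℕ → S) → PathSpace S := fun x => x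
  have hm : Measurable φ := fun s hs => hb ▸ hs
  have hs : ∑ s, ENNReal.ofReal (p s) = 1 := by
    rw [← ENNReal.ofReal_sum_of_nonneg fun s _ => h0 s, h1, ENNReal.ofReal_one]
  let q : Measure S := (PMF.ofFintype (fun s => ENNReal.ofReal (p s)) hs).toMeasure
  have hq : ∀ s, q {s} = ENNReal.ofReal (p s) := fun s => by
    simp [q]
  let ν : Measure (ℕ → S) := Measure.infinitePi fun _ : ℕ => q
  let m : ProbabilityMeasure (PathSpace S) :=
    ⟨ν.map φ, Measure.isProbabilityMeasure_map hm.aemeasurable⟩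
  refine ⟨m, fun s => ⟨h0 s, h1 ▸ Finset.single_le_sum (fun r _ => h0 r) (Finset.mem_univ s)⟩, h1,
    fun t => ?_⟩
  have h2 : (m : Measure (PathSpace S)) (cylinder t) = ν (φ ⁻¹' cylinder t) :=
    Measure.map_apply hm (measurableSet_cylinder t)
  -- The guard `i < t.length` lets the sides of the box be indexed by all of ℕ.
  have h3 : φ ⁻¹' cylinder t = (Finset.range t.length : Set ℕ).pi
      fun i => {s | ∀ h : i < t.length, s = t[i]} := by
    ext x
    simp only [Set.mem_pi, Finset.coe_range, Set.mem_Iio, Set.mem_preimage, Set.mem_ofPred_eq]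
    exact ⟨fun h i _ hi => h ⟨i, hi⟩, fun h i => h i i.2 i.2⟩
  rw [h2, h3, Measure.infinitePi_pi (fun _ : ℕ => q) fun _ _ => MeasurableSpace.measurableSet_top,
    Finset.prod_range]
  have h4 : ∀ i : Fin t.length,
      q {s | ∀ h : (i : ℕ) < t.length, s = t[(i : ℕ)]} = ENNReal.ofReal (p (t.get i)) := by
    intro i
    rw [← hq]
    congr 1
    ext s
    simp
  simp only [h4]
  rw [← ENNReal.ofReal_prod_of_nonneg fun _ _ => h0 _, ← List.prod_ofFn]
  congr 2
  refine List.ext_get (by simp) fun n h5 h6 => ?_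
  simp

end Measures

/-! ### The KMS condition at eigenvectors of the action -/

section Eigen

/-- Identity theorem: 0 is an accumulation point of the real line. -/
theorem entire_eq_of_eq_on_real {E : Type*} [NormedAddCommGroup E] [NormedSpace ℂ E]
    [CompleteSpace E] {f g : ℂ → E} (hf : Differentiable ℂ f) (hg : Differentiable ℂ g)
    (h : ∀ t : ℝ, f t = g t) : f = g := by
  refine AnalyticOnNhd.eq_of_frequently_eq (z₀ := 0) (fun z _ => hf.analyticAt z)
    (fun z _ => hg.analyticAt z) ?_
  have ht : Filter.Tendsto (fun t : ℝ => (t : ℂ)) (nhdsWithin 0 {0}ᶜ) (nhdsWithin 0 {0}ᶜ) := by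
    refine Filter.Tendsto.inf (by simpa using Complex.continuous_ofReal.tendsto 0) ?_
    simp
  exact ht.frequently (Filter.Eventually.frequently (Filter.Eventually.of_forall h))

/-- If an entire function is bounded on a horizontal strip, and almost equal to a constant on each
of the two boundary lines, then the two constants are almost equal. -/
theorem norm_sub_le_of_strip {g : ℂ → ℂ} (hg : Differentiable ℂ g) {β C ε δ : ℝ} {c d : ℂ}
    (hC : ∀ x : ℝ, ∀ y ∈ Set.uIcc 0 β, ‖g (x + y * Complex.I)‖ ≤ C)
    (hc : ∀ x : ℝ, ‖g x - c‖ ≤ ε) (hd : ∀ x : ℝ, ‖g (x + β * Complex.I) - d‖ ≤ δ) :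
    ‖c - d‖ ≤ ε + δ := by
  -- Cauchy's theorem on the rectangle with corners 0 and T + iβ: the horizontal sides contribute Tc
  -- and Td up to the given errors, the vertical ones at most C|β| each. Dividing by T and letting T
  -- grow removes the latter.
  have main : ∀ T : ℝ, 0 < T → ‖c - d‖ ≤ ε + δ + 2 * C * |β| * T⁻¹ := by
    intro T hT
    have hR := Complex.integral_boundary_rect_eq_zero_of_differentiableOn g 0 (T + β * Complex.I)
      hg.differentiableOn
    simp only [Complex.zero_re, Complex.zero_im, Complex.ofReal_zero, zero_mul, add_zero, zero_add,
      Complex.add_re, Complex.ofReal_re, Complex.mul_re, Complex.I_re, mul_zero, Complex.ofReal_im,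
      Complex.I_im, mul_one, sub_self, Complex.add_im, Complex.mul_im] at hR
    have cont : ∀ y : ℝ, Continuous fun x : ℝ => g (x + y * Complex.I) := fun y => by
      have := hg.continuous; fun_prop
    have cont0 : Continuous fun x : ℝ => g x := by
      have := hg.continuous; fun_prop
    have i1 : ‖(∫ x in (0:ℝ)..T, g x) - T * c‖ ≤ ε * T := by
      have : (∫ x in (0:ℝ)..T, g x) - T * c = ∫ x in (0:ℝ)..T, (g x - c) := by
        rw [intervalIntegral.integral_sub (cont0.intervalIntegrable _ _) (by simp)]
        simp
      rw [this]
      simpa [abs_of_pos hT] using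
        intervalIntegral.norm_integral_le_of_norm_le_const (a := 0) (b := T) fun x _ => hc x
    have i2 : ‖(∫ x in (0:ℝ)..T, g (x + β * Complex.I)) - T * d‖ ≤ δ * T := by
      have : (∫ x in (0:ℝ)..T, g (x + β * Complex.I)) - T * d =
          ∫ x in (0:ℝ)..T, (g (x + β * Complex.I) - d) := by
        rw [intervalIntegral.integral_sub ((cont β).intervalIntegrable _ _) (by simp)]
        simp
      rw [this]
      simpa [abs_of_pos hT] using
        intervalIntegral.norm_integral_le_of_norm_le_const (a := 0) (b := T) fun x _ => hd x
    have i3 : ∀ x : ℝ, ‖∫ y in (0:ℝ)..β, g (x + y * Complex.I)‖ ≤ C * |β| := fun x => by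
      simpa using intervalIntegral.norm_integral_le_of_norm_le_const (a := 0) (b := β)
        fun y hy => hC x y (Set.uIoc_subset_uIcc hy)
    have i4 := i3 T
    have i5 := i3 0
    simp only [Complex.ofReal_zero, zero_add] at i5
    set A := ∫ x in (0:ℝ)..T, g x
    set B := ∫ x in (0:ℝ)..T, g (x + β * Complex.I)
    set P := ∫ y in (0:ℝ)..β, g (T + y * Complex.I)
    set Q := ∫ y in (0:ℝ)..β, g (y * Complex.I)
    have e : (T : ℂ) * (c - d) = -(A - T * c) + (B - T * d) + (-(Complex.I * P) + Complex.I * Q) := by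
      simp only [smul_eq_mul] at hR
      linear_combination hR
    have n1 : ‖(T : ℂ) * (c - d)‖ ≤ ε * T + δ * T + (C * |β| + C * |β|) := by
      rw [e]
      refine (norm_add_le _ _).trans (add_le_add ((norm_add_le _ _).trans (add_le_add ?_ i2)) ?_)
      · rwa [norm_neg]
      · refine (norm_add_le _ _).trans (add_le_add ?_ ?_)
        · simpa using i4
        · simpa using i5
    rw [norm_mul, Complex.norm_real, Real.norm_of_nonneg hT.le] at n1
    have : T * ‖c - d‖ ≤ T * (ε + δ + 2 * C * |β| * T⁻¹) := by
      refine n1.trans (le_of_eq ?_)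
      field_simp
      ring
    exact le_of_mul_le_mul_left this hT
  have lim : Filter.Tendsto (fun T : ℝ => ε + δ + 2 * C * |β| * T⁻¹) Filter.atTop
      (nhds (ε + δ + 2 * C * |β| * 0)) :=
    (tendsto_inv_atTop_zero.const_mul _).const_add _
  rw [mul_zero, add_zero] at lim
  exact ge_of_tendsto lim ((Filter.eventually_gt_atTop 0).mono main)

variable {A : Type*} [CStarAlgebra A]

/-- A bounded KMS state satisfies the KMS condition at every eigenvector of the action, whether or
not it is in the given dense subalgebra. -/
theorem IsKMSState.apply_mul_of_eigenvector {α : ℝ → A ≃⋆ₐ[ℂ] A} {β : ℝ} {ω : A →ₗ[ℂ] ℂ}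
    (h : IsKMSState α β ω) (hα : ∀ r t a, α (r + t) a = α r (α t a))
    (hω : ∀ a, ‖ω a‖ ≤ ‖a‖) {a : A} {l : ℝ}
    (ha : ∀ t : ℝ, α t a = Complex.exp (Complex.I * ((t * l : ℝ) : ℂ)) • a) (b : A) :
    ω (a * b) = Complex.exp ((-(β * l) : ℝ) : ℂ) * ω (b * a) := by
  obtain ⟨-, D, hD, hinv, hkms⟩ := h
  have hiso : ∀ (t : ℝ) (x : A), ‖α t x‖ = ‖x‖ := fun t x => StarAlgEquiv.norm_map (α t) x
  have hαc : ∀ t : ℝ, ∀ f : ℂ → A, Differentiable ℂ f → Differentiable ℂ fun z => α t (f z) := by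
    intro t f hf
    let L : A →L[ℂ] A := LinearMap.mkContinuous
      ((α t : A →ₐ[ℂ] A).toLinearMap) 1 fun x => by
        rw [one_mul]; exact (hiso t x).le
    exact L.differentiable.comp hf
  let W : A →L[ℂ] ℂ := ω.mkContinuous 1 fun x => by rw [one_mul]; exact hω x
  have hW : ∀ x, W x = ω x := fun _ => rfl
  set E : ℝ := Real.exp (β * l) with hE
  -- the estimate for elements of the dense subalgebra
  have key : ∀ c ∈ D, ∀ b ∈ D,
      ‖ω (b * a) - (E : ℂ) * ω (a * b)‖ ≤ (1 + E) * (‖b‖ * ‖c - a‖) := by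
    intro c hc b hb
    obtain ⟨f, ⟨hf, hfα⟩, -⟩ := hkms c hc
    -- Translation covariance of the extension makes ‖f(x + iy)‖ independent of x, which bounds f on
    -- the strip.
    have hshift : ∀ (x : ℝ) (z : ℂ), f (x + z) = α x (f z) := by
      intro x z
      have := entire_eq_of_eq_on_real (f := fun z => f (x + z)) (g := fun z => α x (f z))
        (hf.comp (differentiable_id.const_add _)) (hαc x f hf) (fun t => by
          rw [← Complex.ofReal_add, hfα, hfα, hα])
      exact congrFun this z
    -- The KMS condition at α_x c, which lies in D by invariance and whose entire extension is the
    -- translate of f.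
    have htop : ∀ x : ℝ, ω (b * f (x + β * Complex.I)) = ω (α x c * b) := by
      intro x
      obtain ⟨f', ⟨hf', hfα'⟩, hk⟩ := hkms _ (hinv x c hc)
      have : f' = fun z => f (x + z) :=
        entire_eq_of_eq_on_real hf' (hf.comp (differentiable_id.const_add _)) fun t => by
          rw [hfα', ← Complex.ofReal_add, hfα, ← hα, add_comm]
      rw [hk b hb, this, mul_comm Complex.I]
    -- The exponential cancels the rotation of the eigenvector: if c were equal to a, g would be the
    -- constant ω(ba) on ℝ and e^{βl} ω(ab) on ℝ + iβ. The errors are controlled by ‖c - a‖.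
    let g : ℂ → ℂ := fun z => Complex.exp (-(Complex.I * z * l)) * W (b * f z)
    have hg : Differentiable ℂ g := by
      refine Differentiable.mul (by fun_prop) ?_
      exact W.differentiable.comp (hf.const_mul b)
    obtain ⟨M, hM⟩ := (isCompact_uIcc (a := (0:ℝ)) (b := β)).exists_bound_of_continuousOn
      (f := fun y : ℝ => Real.exp (y * l) * (‖b‖ * ‖f (y * Complex.I)‖)) (by
        have := hf.continuous
        fun_prop)
    have hexp : ∀ x y : ℝ, Complex.exp (-(Complex.I * (x + y * Complex.I) * l)) =
        Complex.exp (y * l) * Complex.exp (-(x * l : ℝ) * Complex.I) := by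
      intro x y
      rw [← Complex.exp_add]
      congr 1
      push_cast
      linear_combination (-(y : ℂ) * l) * Complex.I_sq
    have hexpn : ∀ x y : ℝ, ‖Complex.exp (-(Complex.I * (x + y * Complex.I) * l))‖ =
        Real.exp (y * l) := by
      intro x y
      rw [hexp, norm_mul, ← Complex.ofReal_neg, Complex.norm_exp_ofReal_mul_I, mul_one,
        ← Complex.ofReal_mul, ← Complex.ofReal_exp, Complex.norm_real,
        Real.norm_of_nonneg (Real.exp_pos _).le]
    have hstrip : ∀ x : ℝ, ∀ y ∈ Set.uIcc 0 β, ‖g (x + y * Complex.I)‖ ≤ M := by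
      intro x y hy
      refine le_trans ?_ ((le_abs_self _).trans (hM y hy))
      simp only [g]
      rw [norm_mul, hexpn, hW]
      refine mul_le_mul_of_nonneg_left ?_ (Real.exp_pos _).le
      refine (hω _).trans ((norm_mul_le _ _).trans ?_)
      rw [hshift, hiso]
    have hlow : ∀ x : ℝ, ‖g x - ω (b * a)‖ ≤ ‖b‖ * ‖c - a‖ := by
      intro x
      have e : g x - ω (b * a) = Complex.exp (-(Complex.I * (x + (0:ℝ) * Complex.I) * l)) *
          ω (b * α x (c - a)) := by
        have e1 : Complex.exp (-(Complex.I * (x + (0:ℝ) * Complex.I) * l)) *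
            Complex.exp (Complex.I * ((x * l : ℝ) : ℂ)) = 1 := by
          rw [← Complex.exp_add, Complex.exp_eq_one_iff]
          exact ⟨0, by push_cast; ring⟩
        rw [map_sub, ha, mul_sub, map_sub, mul_smul_comm, map_smul, smul_eq_mul, mul_sub,
          ← mul_assoc, e1, one_mul]
        simp [g, hfα, hW]
      rw [e, norm_mul, hexpn, zero_mul, Real.exp_zero, one_mul]
      refine (hω _).trans ((norm_mul_le _ _).trans ?_)
      rw [hiso]
    have hup : ∀ x : ℝ, ‖g (x + β * Complex.I) - (E : ℂ) * ω (a * b)‖ ≤ E * (‖b‖ * ‖c - a‖) := by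
      intro x
      have e : g (x + β * Complex.I) - (E : ℂ) * ω (a * b) =
          Complex.exp (-(Complex.I * (x + β * Complex.I) * l)) * ω (α x (c - a) * b) := by
        have e1 : Complex.exp (-(Complex.I * (x + β * Complex.I) * l)) *
            Complex.exp (Complex.I * ((x * l : ℝ) : ℂ)) = E := by
          rw [hE, Complex.ofReal_exp, ← Complex.exp_add]
          congr 1
          push_cast
          linear_combination (-(β : ℂ) * l) * Complex.I_sq
        rw [map_sub, ha, sub_mul, map_sub, smul_mul_assoc, map_smul, smul_eq_mul, mul_sub,
          ← mul_assoc, e1, ← htop]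
        rfl
      rw [e, norm_mul, hexpn]
      refine mul_le_mul_of_nonneg_left ?_ (Real.exp_pos _).le
      refine (hω _).trans ((norm_mul_le _ _).trans ?_)
      rw [hiso, mul_comm]
    exact (norm_sub_le_of_strip hg hstrip hlow hup).trans (le_of_eq (by ring))
  have heq : ∀ b ∈ D, W (b * a) = (E : ℂ) * W (a * b) := by
    intro b hb
    -- Let c tend to a within D; afterwards b is freed by density in the same way.
    have hle : ‖ω (b * a) - (E : ℂ) * ω (a * b)‖ ≤ (1 + E) * (‖b‖ * ‖a - a‖) := by
      have hcl : IsClosed {c : A | ‖ω (b * a) - (E : ℂ) * ω (a * b)‖ ≤ (1 + E) * (‖b‖ * ‖c - a‖)} :=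
        isClosed_le continuous_const (by fun_prop)
      exact hcl.closure_subset_iff.2 (fun c hc => key c hc b hb) (hD a)
    simp only [sub_self, norm_zero, mul_zero, norm_le_zero_iff] at hle
    exact sub_eq_zero.1 hle
  have hall : ∀ b, W (b * a) = (E : ℂ) * W (a * b) := by
    have hcl : IsClosed {b : A | W (b * a) = (E : ℂ) * W (a * b)} :=
      isClosed_eq (by fun_prop) (by fun_prop)
    exact fun b => hcl.closure_subset_iff.2 heq (hD b)
  have hb := hall b
  rw [hW, hW] at hb
  rw [hb, hE, ← mul_assoc, Complex.ofReal_exp, ← Complex.exp_add]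
  simp

end Eigen

/-! ### Consequences for KMS measures -/

section Measure

theorem norm_expectation_le {S : Type*} (a : BH S) (x : PathSpace S) :
    ‖expectation a x‖ ≤ ‖a‖ := by
  have h1 : ‖(bas (x, 0) : Hilb S)‖ = 1 := orthonormal_bas.1 _
  calc ‖expectation a x‖ ≤ ‖(bas (x, 0) : Hilb S)‖ * ‖a (bas (x, 0))‖ := norm_inner_le_norm _ _
    _ ≤ 1 * (‖a‖ * 1) := by
        rw [h1]
        exact mul_le_mul_of_nonneg_left (h1 ▸ a.le_opNorm _) zero_le_one
    _ = ‖a‖ := by ring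

variable {G : Type*} [Group G] {Y : Finset G}

theorem action_add (F : Y → ℝ) (r t : ℝ) (a : corner Y) :
    action F (r + t) a = action F r (action F t a) := by
  apply Subtype.ext
  change conjU F (r + t) a = conjU F r (conjU F t a)
  rw [conjU_apply, conjU_apply, conjU_apply, neg_add_rev, U_add, U_add]
  simp only [mul_assoc]

theorem integral_expectation_VW {S : Type*} [Fintype S] (m : ProbabilityMeasure (PathSpace S))
    (t u : List S) :
    ∫ x, expectation (VW t * star (VW u)) x ∂(m : Measure (PathSpace S)) =
      if t = u then (((m : Measure (PathSpace S)).real (cylinder t) : ℝ) : ℂ) else 0 := by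
  simp only [expectation_VW]
  split_ifs with h
  · have e : (fun x => if t = u ∧ x ∈ cylinder t then (1 : ℂ) else 0) =
        (cylinder t).indicator fun _ => 1 := by
      ext x
      simp [h, Set.indicator_apply]
    rw [e, integral_indicator_const _ (measurableSet_cylinder t)]
    simp
  · simp [h]

/-- The quotient of the measures of the cylinders of two words with the same value in the group. -/
theorem IsKMSMeasure.measureReal_cylinder {F : Y → ℝ} {β : ℝ}
    {m : ProbabilityMeasure (PathSpace Y)} (h : IsKMSMeasure F β m) {t u : List Y}
    (htu : wordProd t = wordProd u) :
    Real.exp (β * potential F t) * (m : Measure (PathSpace Y)).real (cylinder t) =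
      Real.exp (β * potential F u) * (m : Measure (PathSpace Y)).real (cylinder u) := by
  obtain ⟨ω, hω, hk⟩ := h
  have hmem : ∀ t u : List Y, wordProd t = wordProd u → VW t * star (VW u) ∈ corner Y :=
    fun t u htu => subset_closure (Submodule.subset_span ⟨t, u, htu, rfl⟩)
  have hone : ∀ t : List Y, star (VW t) * VW t = 1 := by
    intro t
    induction t with
    | nil => simp [VW_nil]
    | cons s t ih =>
      rw [VW_cons, star_mul, mul_assoc, ← mul_assoc (star (V s)), star_V_mul_V, if_pos rfl,
        one_mul, ih]
  -- For a = V_t V_u^*, a a^* = V_t V_t^* and a^* a = V_u V_u^*, whose expectations are cylinder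
  -- indicators.
  have hval : ∀ t u (htu : wordProd t = wordProd u),
      ω (⟨VW t * star (VW u), hmem t u htu⟩ * ⟨VW u * star (VW t), hmem u t htu.symm⟩) =
        (((m : Measure (PathSpace Y)).real (cylinder t) : ℝ) : ℂ) := by
    intro t u htu
    rw [hω]
    change ∫ x, expectation (VW t * star (VW u) * (VW u * star (VW t))) x ∂_ = _
    have : VW t * star (VW u) * (VW u * star (VW t)) = VW t * star (VW t) := by
      rw [mul_assoc, ← mul_assoc (star (VW u)), hone, one_mul]
    rw [this, integral_expectation_VW, if_pos rfl]
  have hE := hk.apply_mul_of_eigenvector (action_add F) (fun a => by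
      rw [hω]
      refine (norm_integral_le_of_norm_le_const (C := ‖a‖)
        (Filter.Eventually.of_forall fun x => norm_expectation_le (a : BH Y) x)).trans ?_
      simp)
    (a := ⟨VW t * star (VW u), hmem t u htu⟩) (l := potential F t - potential F u)
    (fun r => Subtype.ext (conjU_VW_star F r t u)) ⟨VW u * star (VW t), hmem u t htu.symm⟩
  rw [hval t u htu, hval u t htu.symm, ← Complex.ofReal_exp, ← Complex.ofReal_mul,
    Complex.ofReal_inj] at hE
  rw [hE, ← mul_assoc, ← Real.exp_add]
  congr 2
  ring

end Measure

/-! ### The KMS state of a Bernoulli measure -/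

section KMSCondition

variable {A : Type*} [CStarAlgebra A]

/-- The element `a` is analytic and satisfies the KMS condition against the elements of `D`. -/
def KMSConditionAt (α : ℝ → A ≃⋆ₐ[ℂ] A) (β : ℝ) (ω : A →ₗ[ℂ] ℂ)
    (D : NonUnitalStarSubalgebra ℂ A) (a : A) : Prop :=
  ∃ f : ℂ → A, IsEntireExtension α a f ∧ ∀ b ∈ D, ω (a * b) = ω (b * f (Complex.I * β))

variable {α : ℝ → A ≃⋆ₐ[ℂ] A} {β : ℝ} {ω : A →ₗ[ℂ] ℂ} {D : NonUnitalStarSubalgebra ℂ A}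

theorem kmsConditionAt_zero : KMSConditionAt α β ω D 0 :=
  ⟨fun _ => 0, ⟨differentiable_const 0, fun t => (map_zero (α t)).symm⟩, fun b _ => by simp⟩

theorem KMSConditionAt.add {a c : A} (ha : KMSConditionAt α β ω D a)
    (hc : KMSConditionAt α β ω D c) : KMSConditionAt α β ω D (a + c) := by
  obtain ⟨f, ⟨hf, hfa⟩, hfk⟩ := ha
  obtain ⟨g, ⟨hg, hgc⟩, hgk⟩ := hc
  refine ⟨fun z => f z + g z, ⟨hf.add hg, fun t => ?_⟩, fun b hb => ?_⟩
  · rw [map_add, ← hfa, ← hgc]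
  · rw [add_mul, mul_add, map_add, map_add, hfk b hb, hgk b hb]

theorem KMSConditionAt.smul {a : A} (ha : KMSConditionAt α β ω D a) (c : ℂ) :
    KMSConditionAt α β ω D (c • a) := by
  obtain ⟨f, ⟨hf, hfa⟩, hfk⟩ := ha
  refine ⟨fun z => c • f z, ⟨hf.const_smul c, fun t => ?_⟩, fun b hb => ?_⟩
  · rw [map_smul, ← hfa]
  · rw [smul_mul_assoc, mul_smul_comm, map_smul, map_smul, hfk b hb]

/-- The orbit of an eigenvector extends explicitly to z ↦ e^{izl} a, with value e^{-βl} a at iβ. -/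
theorem kmsConditionAt_of_eigenvector {a : A} {l : ℝ}
    (ha : ∀ t : ℝ, α t a = Complex.exp (Complex.I * ((t * l : ℝ) : ℂ)) • a)
    (h : ∀ b ∈ D, ω (a * b) = (Real.exp (-β * l) : ℝ) * ω (b * a)) :
    KMSConditionAt α β ω D a := by
  refine ⟨fun z => Complex.exp (Complex.I * (z * l)) • a, ⟨by fun_prop, fun t => ?_⟩,
    fun b hb => ?_⟩
  · rw [ha, Complex.ofReal_mul]
  · rw [h b hb, mul_smul_comm, map_smul, smul_eq_mul, Complex.ofReal_exp]
    congr 2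
    push_cast
    linear_combination (-(β : ℂ) * l) * Complex.I_sq

end KMSCondition

/-! ### Cyclic relations for Bernoulli measures on the whole Cuntz algebra -/

section CuntzGenerators

variable {S : Type*}

/-- Zero, and the elements `V t (V u)*`. -/
def IsCuntzMonomial (b : BH S) : Prop := b = 0 ∨ ∃ t u : List S, b = VW t * star (VW u)

theorem IsCuntzMonomial.mul {a b : BH S} (ha : IsCuntzMonomial a) (hb : IsCuntzMonomial b) :
    IsCuntzMonomial (a * b) := by
  rcases ha with rfl | ⟨t₁, u₁, rfl⟩
  · exact Or.inl (zero_mul b)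
  rcases hb with rfl | ⟨t₂, u₂, rfl⟩
  · exact Or.inl (mul_zero _)
  have h : VW t₁ * star (VW u₁) * (VW t₂ * star (VW u₂)) =
      VW t₁ * (star (VW u₁) * VW t₂) * star (VW u₂) := by simp only [mul_assoc]
  rw [h]
  rcases star_VW_mul_VW u₁ t₂ with ⟨x, -, hx⟩ | ⟨x, -, hx⟩ | hx
  · exact Or.inr ⟨t₁ ++ x, u₂, by rw [hx, VW_append]⟩
  · exact Or.inr ⟨t₁, u₂ ++ x, by rw [hx, VW_append, star_mul, mul_assoc]⟩
  · exact Or.inl (by rw [hx]; simp)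

theorem isCuntzMonomial_VW (t : List S) : IsCuntzMonomial (VW t) :=
  Or.inr ⟨t, [], by simp [VW_nil]⟩

theorem isCuntzMonomial_star_VW (t : List S) : IsCuntzMonomial (star (VW t)) :=
  Or.inr ⟨[], t, by simp [VW_nil]⟩

theorem VW_singleton (s : S) : VW [s] = V s := by simp [VW]

theorem expectation_add (a b : BH S) (x : PathSpace S) :
    expectation (a + b) x = expectation a x + expectation b x := by
  simp [expectation]

theorem expectation_sub (a b : BH S) (x : PathSpace S) :
    expectation (a - b) x = expectation a x - expectation b x := by
  simp [expectation]

theorem expectation_smul (c : ℂ) (a : BH S) (x : PathSpace S) :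
    expectation (c • a) x = c * expectation a x := by
  simp [expectation]

theorem expectation_star_mul_self (a : BH S) (x : PathSpace S) :
    expectation (star a * a) x = ((‖a (bas (x, 0))‖ ^ 2 : ℝ) : ℂ) := by
  rw [expectation, mul_apply_eq_comp, ContinuousLinearMap.star_eq_adjoint,
    ContinuousLinearMap.adjoint_inner_right, inner_self_eq_norm_sq_to_K]
  simp

/-- The functional `a ↦ ∫ E(a) dm`. -/
def meanExpectation (m : ProbabilityMeasure (PathSpace S)) (a : BH S) : ℂ :=
  ∫ x, expectation a x ∂(m : Measure (PathSpace S))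

theorem meanExpectation_zero (m : ProbabilityMeasure (PathSpace S)) : meanExpectation m 0 = 0 := by
  simp [meanExpectation, expectation]

theorem prod_map_exp (F : S → ℝ) (β : ℝ) (t : List S) :
    (t.map fun s => Real.exp (-β * F s)).prod = Real.exp (-β * potential F t) := by
  induction t with
  | nil => simp [potential]
  | cons s t ih =>
    rw [List.map_cons, List.prod_cons, ih, ← Real.exp_add]
    congr 1
    simp [potential]
    ring

theorem exp_potential_cons (F : S → ℝ) (β : ℝ) (s : S) (t : List S) :
    ((Real.exp (-β * potential F (s :: t)) : ℝ) : ℂ) =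
      (Real.exp (-β * F s) : ℝ) * (Real.exp (-β * potential F t) : ℝ) := by
  rw [← Complex.ofReal_mul, ← Real.exp_add]
  congr 2
  simp [potential]
  ring

variable [Fintype S] {F : S → ℝ} {β : ℝ} {m : ProbabilityMeasure (PathSpace S)}

theorem IsBernoulli.meanExpectation_VW (hm : IsBernoulli m fun s => Real.exp (-β * F s))
    (t u : List S) : meanExpectation m (VW t * star (VW u)) =
      if t = u then ((Real.exp (-β * potential F t) : ℝ) : ℂ) else 0 := by
  rw [meanExpectation, integral_expectation_VW, Measure.real, hm.2.2, prod_map_exp,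
    ENNReal.toReal_ofReal (Real.exp_pos _).le]

/-- A single V_s is in general not in the corner, so the relation is proved for all monomials b of
the Cuntz algebra. For b = V_t V_u^* both sides vanish unless u = st, where the means of V_u V_u^*
and V_t V_t^* differ by the factor e^{-βF(s)}. -/
theorem IsBernoulli.meanExpectation_V_mul (hm : IsBernoulli m fun s => Real.exp (-β * F s))
    (s : S) {b : BH S} (hb : IsCuntzMonomial b) :
    meanExpectation m (V s * b) = (Real.exp (-β * F s) : ℝ) * meanExpectation m (b * V s) := by
  rcases hb with rfl | ⟨t, u, rfl⟩
  · simp [meanExpectation_zero]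
  rw [← mul_assoc, ← VW_cons, hm.meanExpectation_VW, mul_assoc]
  cases u with
  | nil =>
    have : VW t * (star (VW []) * V s) = VW (t ++ [s]) * star (VW []) := by
      simp [VW_nil, VW_append, VW_singleton]
    rw [this, hm.meanExpectation_VW]
    simp
  | cons r u =>
    rw [VW_cons, star_mul, mul_assoc, star_V_mul_V]
    by_cases h : r = s
    · subst h
      rw [if_pos rfl, mul_one, hm.meanExpectation_VW]
      by_cases h2 : t = u
      · simp only [h2, if_true]
        exact exp_potential_cons F β r u
      · simp [h2]
    · simp [h, Ne.symm h, meanExpectation_zero]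

theorem IsBernoulli.meanExpectation_mul_star_V (hm : IsBernoulli m fun s => Real.exp (-β * F s))
    (s : S) {b : BH S} (hb : IsCuntzMonomial b) :
    meanExpectation m (b * star (V s)) =
      (Real.exp (-β * F s) : ℝ) * meanExpectation m (star (V s) * b) := by
  rcases hb with rfl | ⟨t, u, rfl⟩
  · simp [meanExpectation_zero]
  rw [mul_assoc, ← star_mul, ← VW_cons, hm.meanExpectation_VW, ← mul_assoc]
  cases t with
  | nil =>
    have : star (V s) * VW [] * star (VW u) = VW [] * star (VW (u ++ [s])) := by
      simp [VW_nil, VW_append, VW_singleton]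
    rw [this, hm.meanExpectation_VW]
    simp
  | cons r t =>
    rw [VW_cons, ← mul_assoc, star_V_mul_V]
    by_cases h : s = r
    · subst h
      rw [if_pos rfl, one_mul, hm.meanExpectation_VW]
      by_cases h2 : t = u
      · simp only [h2, if_true]
        exact exp_potential_cons F β s u
      · simp [h2]
    · simp [h, Ne.symm h, meanExpectation_zero]

theorem IsBernoulli.meanExpectation_VW_mul (hm : IsBernoulli m fun s => Real.exp (-β * F s))
    (t : List S) {b : BH S} (hb : IsCuntzMonomial b) :
    meanExpectation m (VW t * b) =
      (Real.exp (-β * potential F t) : ℝ) * meanExpectation m (b * VW t) := by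
  induction t generalizing b with
  | nil => simp [VW_nil, potential]
  | cons s t ih =>
    have hs : IsCuntzMonomial (V s) := VW_singleton s ▸ isCuntzMonomial_VW [s]
    rw [VW_cons, mul_assoc, hm.meanExpectation_V_mul s ((isCuntzMonomial_VW t).mul hb), mul_assoc,
      ih (hb.mul hs), exp_potential_cons]
    simp only [mul_assoc]

theorem IsBernoulli.meanExpectation_mul_star_VW (hm : IsBernoulli m fun s => Real.exp (-β * F s))
    (u : List S) {b : BH S} (hb : IsCuntzMonomial b) :
    meanExpectation m (b * star (VW u)) =
      (Real.exp (-β * potential F u) : ℝ) * meanExpectation m (star (VW u) * b) := by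
  induction u generalizing b with
  | nil => simp [VW_nil, potential]
  | cons s u ih =>
    have hs : IsCuntzMonomial (star (V s)) := VW_singleton s ▸ isCuntzMonomial_star_VW [s]
    rw [VW_cons, star_mul, ← mul_assoc,
      hm.meanExpectation_mul_star_V s (hb.mul (isCuntzMonomial_star_VW u)), ← mul_assoc,
      ih (hs.mul hb), exp_potential_cons]
    simp only [mul_assoc]

/-- Both products are cycled to V_u^* b V_t: the left one picks up e^{-βF(t)}, the right one
e^{-βF(u)}. -/
theorem IsBernoulli.meanExpectation_monomial_mul
    (hm : IsBernoulli m fun s => Real.exp (-β * F s))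
    (t u : List S) {b : BH S} (hb : IsCuntzMonomial b) :
    meanExpectation m (VW t * star (VW u) * b) =
      (Real.exp (-β * (potential F t - potential F u)) : ℝ) *
        meanExpectation m (b * (VW t * star (VW u))) := by
  rw [mul_assoc, hm.meanExpectation_VW_mul t ((isCuntzMonomial_star_VW u).mul hb), ← mul_assoc b,
    hm.meanExpectation_mul_star_VW u (hb.mul (isCuntzMonomial_VW t)), ← mul_assoc,
    ← Complex.ofReal_mul, ← Real.exp_add, mul_assoc (star (VW u))]
  congr 3
  ring_nf

end CuntzGenerators

/-! ### The KMS state on the corner -/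

section KMSState

variable {G : Type*} [Group G] {Y : Finset G}

theorem cornerSpan_le_corner {a : BH Y} (ha : a ∈ Submodule.span ℂ (cornerGen Y)) : a ∈ corner Y :=
  subset_closure (s := (cornerSpan Y : Set (BH Y))) ha

/-- On the span, E(a) is a linear combination of cylinder indicators; contractivity of E passes
measurability to limits. -/
theorem measurable_expectation {a : BH Y} (ha : a ∈ corner Y) : Measurable (expectation a) := by
  have hspan : ∀ a ∈ Submodule.span ℂ (cornerGen Y), Measurable (expectation a) := by
    intro a ha
    induction ha using Submodule.span_induction with
    | mem a ha =>
      obtain ⟨t, u, -, rfl⟩ := ha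
      have : expectation (VW t * star (VW u)) =
          fun x => if x ∈ {x | t = u} ∩ cylinder t then (1 : ℂ) else 0 := by
        ext x
        rw [expectation_VW]
        congr
      rw [this]
      exact Measurable.ite ((MeasurableSet.const _).inter (measurableSet_cylinder t))
        measurable_const measurable_const
    | zero =>
      have : expectation (0 : BH Y) = fun _ => 0 := by ext x; simp [expectation]
      rw [this]
      exact measurable_const
    | add a b _ _ h h' =>
      rw [funext (expectation_add a b)]
      exact h.add h'
    | smul c a _ h =>
      rw [funext (expectation_smul c a)]
      exact h.const_mul c
  obtain ⟨u, hu, hlim⟩ := mem_closure_iff_seq_limit.1 ha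
  refine measurable_of_tendsto_metrizable (fun n => hspan (u n) (hu n)) (tendsto_pi_nhds.2 ?_)
  intro x
  rw [tendsto_iff_norm_sub_tendsto_zero] at hlim ⊢
  refine squeeze_zero (fun _ => norm_nonneg _) (fun n => ?_) hlim
  rw [← expectation_sub]
  exact norm_expectation_le _ _

theorem integrable_expectation (m : ProbabilityMeasure (PathSpace Y)) {a : BH Y}
    (ha : a ∈ corner Y) : Integrable (expectation a) (m : Measure (PathSpace Y)) :=
  Integrable.of_bound (measurable_expectation ha).aestronglyMeasurable ‖a‖
    (Filter.Eventually.of_forall fun x => norm_expectation_le a x)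

/-- The state `a ↦ ∫ E(a) dm`. -/
def cornerState (m : ProbabilityMeasure (PathSpace Y)) : corner Y →ₗ[ℂ] ℂ where
  toFun a := meanExpectation m a
  map_add' a b := by
    change ∫ x, expectation ((a : BH Y) + (b : BH Y)) x ∂_ = _
    simp only [expectation_add]
    exact integral_add (integrable_expectation m a.2) (integrable_expectation m b.2)
  map_smul' c a := by
    change ∫ x, expectation (c • (a : BH Y)) x ∂_ = _
    simp only [expectation_smul]
    exact integral_const_mul c _

theorem isState_cornerState (m : ProbabilityMeasure (PathSpace Y)) : IsState (cornerState m) := by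
  refine ⟨fun a => ?_, ?_⟩
  · have h : cornerState m (star a * a) =
        ((∫ x, ‖(a : BH Y) (bas (x, 0))‖ ^ 2 ∂(m : Measure (PathSpace Y)) : ℝ) : ℂ) := by
      rw [← integral_complex_ofReal]
      exact integral_congr_ae (Filter.Eventually.of_forall fun x => expectation_star_mul_self _ x)
    rw [h]
    exact ⟨integral_nonneg fun x => sq_nonneg _, Complex.ofReal_im _⟩
  · change ∫ x, expectation (1 : BH Y) x ∂_ = 1
    have : ∀ x : PathSpace Y, expectation (1 : BH Y) x = 1 := fun x => by
      have h := inner_bas (x, 0) (bas (x, 0) : Hilb Y)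
      rwa [bas_apply, if_pos rfl] at h
    simp [this]

/-- The dense *-subalgebra of the corner spanned by the elements `V t (V u)*`. -/
def cornerCore (Y : Finset G) : NonUnitalStarSubalgebra ℂ (corner Y) :=
  ((cornerSpan Y).comap (corner Y).subtype).toNonUnitalStarSubalgebra

theorem dense_cornerCore : Dense (cornerCore Y : Set (corner Y)) := by
  refine Subtype.dense_iff.2 fun a ha => closure_mono ?_ ha
  exact fun b hb => ⟨⟨b, cornerSpan_le_corner hb⟩, hb, rfl⟩

theorem IsBernoulli.cornerState_mul {F : Y → ℝ} {β : ℝ} {m : ProbabilityMeasure (PathSpace Y)}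
    (hm : IsBernoulli m fun s => Real.exp (-β * F s)) (t u : List Y)
    (a : corner Y) (ha : (a : BH Y) = VW t * star (VW u)) {b : BH Y}
    (hb : b ∈ Submodule.span ℂ (cornerGen Y)) :
    cornerState m (a * ⟨b, cornerSpan_le_corner hb⟩) =
      (Real.exp (-β * (potential F t - potential F u)) : ℝ) *
        cornerState m (⟨b, cornerSpan_le_corner hb⟩ * a) := by
  induction hb using Submodule.span_induction with
  | mem b hb =>
    obtain ⟨t', u', -, rfl⟩ := hb
    have := hm.meanExpectation_monomial_mul t u (Or.inr ⟨t', u', rfl⟩)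
    rw [← ha] at this
    exact this
  | zero =>
    change cornerState m (a * 0) = _ * cornerState m (0 * a)
    simp
  | add b c hb hc h h' =>
    have e : (⟨b + c, cornerSpan_le_corner (add_mem hb hc)⟩ : corner Y) =
      ⟨b, cornerSpan_le_corner hb⟩ + ⟨c, cornerSpan_le_corner hc⟩ := rfl
    rw [e, mul_add, add_mul, map_add, map_add, h, h', mul_add]
  | smul c b hb h =>
    have e : (⟨c • b, cornerSpan_le_corner (Submodule.smul_mem _ c hb)⟩ : corner Y) =
      c • ⟨b, cornerSpan_le_corner hb⟩ := rfl
    rw [e, mul_smul_comm, smul_mul_assoc, map_smul, map_smul, h, smul_eq_mul, smul_eq_mul]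
    ring

theorem IsBernoulli.kmsConditionAt {F : Y → ℝ} {β : ℝ} {m : ProbabilityMeasure (PathSpace Y)}
    (hm : IsBernoulli m fun s => Real.exp (-β * F s)) {a : BH Y}
    (ha : a ∈ Submodule.span ℂ (cornerGen Y)) :
    KMSConditionAt (action F) β (cornerState m) (cornerCore Y) ⟨a, cornerSpan_le_corner ha⟩ := by
  induction ha using Submodule.span_induction with
  | mem a ha =>
    obtain ⟨t, u, htu, rfl⟩ := ha
    refine kmsConditionAt_of_eigenvector (l := potential F t - potential F u)
      (fun r => Subtype.ext (conjU_VW_star F r t u)) fun b hb => ?_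
    exact hm.cornerState_mul t u _ rfl hb
  | zero => exact kmsConditionAt_zero
  | add a c ha hc h h' =>
    have e : (⟨a + c, cornerSpan_le_corner (add_mem ha hc)⟩ : corner Y) =
      ⟨a, cornerSpan_le_corner ha⟩ + ⟨c, cornerSpan_le_corner hc⟩ := rfl
    rw [e]
    exact h.add h'
  | smul c a ha h =>
    have e : (⟨c • a, cornerSpan_le_corner (Submodule.smul_mem _ c ha)⟩ : corner Y) =
      c • ⟨a, cornerSpan_le_corner ha⟩ := rfl
    rw [e]
    exact h.smul c

theorem IsBernoulli.isKMSMeasure {F : Y → ℝ} {β : ℝ} {m : ProbabilityMeasure (PathSpace Y)}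
    (hm : IsBernoulli m fun s => Real.exp (-β * F s)) : IsKMSMeasure F β m :=
  ⟨cornerState m, fun _ => rfl, isState_cornerState m, cornerCore Y, dense_cornerCore,
    fun t _ ha => conjU_mem_cornerSpan F t ha, fun _ ha => hm.kmsConditionAt ha⟩

end KMSState

/-! ### From KMS measures to harmonic functions and back -/

section KMSMeasures

variable {G : Type*} [Group G] {Y : Finset G} {F : Y → ℝ} {β : ℝ}
  {m : ProbabilityMeasure (PathSpace Y)}

/-- The harmonic function on the group which is defined by a KMS measure. -/
theorem IsKMSMeasure.exists_harmonic (h : IsKMSMeasure F β m)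
    (hgen : Subsemigroup.closure (Y : Set G) = ⊤) :
    ∃ ψ : G → ℝ, (∀ t : List Y, ψ (wordProd t) =
        Real.exp (β * potential F t) * (m : Measure (PathSpace Y)).real (cylinder t)) ∧
      (∀ g, 0 ≤ ψ g) ∧ ψ 1 = 1 ∧ ∀ g, ψ g = ∑ s : Y, Real.exp (-β * F s) * ψ (g * s) := by
  choose word hword using wordProd_surjective hgen
  let ψ : G → ℝ := fun g =>
    Real.exp (β * potential F (word g)) * (m : Measure (PathSpace Y)).real (cylinder (word g))
  have hψ : ∀ t : List Y, ψ (wordProd t) =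
      Real.exp (β * potential F t) * (m : Measure (PathSpace Y)).real (cylinder t) :=
    fun t => h.measureReal_cylinder (hword _)
  refine ⟨ψ, hψ, fun g => mul_nonneg (Real.exp_pos _).le measureReal_nonneg, ?_, fun g => ?_⟩
  · have := hψ []
    simpa [wordProd, potential, cylinder_nil] using this
  · obtain ⟨t, rfl⟩ := wordProd_surjective hgen g
    have hs : ∀ s : Y, wordProd t * (s : G) = wordProd (t ++ [s]) := fun s => by
      rw [wordProd_append]
      simp [wordProd]
    simp only [hs, hψ]
    -- Harmonicity is the additivity of m over the next letter.
    rw [measureReal_cylinder_eq_sum, Finset.mul_sum]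
    refine Finset.sum_congr rfl fun s _ => ?_
    rw [← mul_assoc, ← Real.exp_add]
    congr 2
    simp [potential]
    ring

/-- A KMS measure whose harmonic function has finitely many values is the Bernoulli measure. -/
theorem isBernoulli_of_finite_range (hgen : Subsemigroup.closure (Y : Set G) = ⊤) {ψ : G → ℝ}
    (hψ : ∀ t : List Y, ψ (wordProd t) =
      Real.exp (β * potential F t) * (m : Measure (PathSpace Y)).real (cylinder t))
    (h0 : ∀ g, 0 ≤ ψ g) (h1 : ψ 1 = 1)
    (hh : ∀ g, ψ g = ∑ s : Y, Real.exp (-β * F s) * ψ (g * s)) (hfin : (Set.range ψ).Finite) :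
    IsBernoulli m fun s => Real.exp (-β * F s) := by
  obtain ⟨hsum, hconst⟩ := harmonic_of_finite_range hgen _ (fun s => Real.exp_pos _) ψ h0 hfin h1 hh
  refine ⟨fun s => ⟨(Real.exp_pos _).le, ?_⟩, hsum, fun t => ?_⟩
  · rw [← hsum]
    exact Finset.single_le_sum (f := fun s : Y => Real.exp (-β * F s))
      (fun r _ => (Real.exp_pos _).le) (Finset.mem_univ s)
  · have h := hψ t
    rw [hconst] at h
    rw [prod_map_exp, ← ofReal_measureReal]
    congr 1
    rw [neg_mul, Real.exp_neg]
    exact eq_inv_of_mul_eq_one_right h.symm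

/-- Both m of a cylinder and the potential are unchanged when blocks are interchanged, so ψ has at
most one value per class of the finite abelianization. -/
theorem IsKMSMeasure.isBernoulli_of_isAbelianMeasure (h : IsKMSMeasure F β m)
    (ha : IsAbelianMeasure m) (hgen : Subsemigroup.closure (Y : Set G) = ⊤)
    (hab : Finite (Abelianization G)) : IsBernoulli m fun s => Real.exp (-β * F s) := by
  obtain ⟨ψ, hψ, h0, h1, hh⟩ := h.exists_harmonic hgen
  refine isBernoulli_of_finite_range hgen hψ h0 h1 hh ?_
  have hswap : ∀ a b c, ψ (a * b * c) = ψ (a * c * b) := by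
    intro a b c
    obtain ⟨t₁, rfl⟩ := wordProd_surjective hgen a
    obtain ⟨t₂, rfl⟩ := wordProd_surjective hgen b
    obtain ⟨t₃, rfl⟩ := wordProd_surjective hgen c
    simp only [← wordProd_append, hψ, Measure.real, ha t₁ t₂ t₃]
    congr 3
    simp [potential]
    ring
  refine (Set.finite_range fun q : Abelianization G => ψ (Quotient.out q)).subset ?_
  rintro _ ⟨g, rfl⟩
  exact ⟨Abelianization.of g, eq_of_abelianization_eq ψ hswap (Quotient.out_eq _)⟩

theorem IsKMSMeasure.isBernoulli_of_finite [Finite G] (h : IsKMSMeasure F β m)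
    (hgen : Subsemigroup.closure (Y : Set G) = ⊤) : IsBernoulli m fun s => Real.exp (-β * F s) := by
  obtain ⟨ψ, hψ, h0, h1, hh⟩ := h.exists_harmonic hgen
  exact isBernoulli_of_finite_range hgen hψ h0 h1 hh (Set.finite_range ψ)

end KMSMeasures

end CayleyKMS

end

theorem mainTheorem8 {G : Type*} [Group G] (Y : Finset G) (hcard : 2 ≤ Y.card)
    (hgen : Subsemigroup.closure (Y : Set G) = ⊤) (F : Y → ℝ) (β : ℝ)
    (hab : Finite (Abelianization G)) :
    ((∃ m : ProbabilityMeasure (CayleyKMS.PathSpace Y),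
        CayleyKMS.IsKMSMeasure F β m ∧ CayleyKMS.IsAbelianMeasure m) ↔
      ∑ s : Y, Real.exp (-β * F s) = 1) ∧
    (∀ m : ProbabilityMeasure (CayleyKMS.PathSpace Y),
      CayleyKMS.IsKMSMeasure F β m → CayleyKMS.IsAbelianMeasure m →
        CayleyKMS.IsBernoulli m (fun s => Real.exp (-β * F s)) ∧
        ∀ m' : ProbabilityMeasure (CayleyKMS.PathSpace Y),
          CayleyKMS.IsKMSMeasure F β m' → CayleyKMS.IsAbelianMeasure m' → m' = m) ∧
    (Group.IsNilpotent G →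
      ((∃ m : ProbabilityMeasure (CayleyKMS.PathSpace Y), CayleyKMS.IsKMSMeasure F β m) ↔
        ∑ s : Y, Real.exp (-β * F s) = 1) ∧
      (∀ m : ProbabilityMeasure (CayleyKMS.PathSpace Y), CayleyKMS.IsKMSMeasure F β m →
        CayleyKMS.IsBernoulli m (fun s => Real.exp (-β * F s)) ∧
        ∀ m' : ProbabilityMeasure (CayleyKMS.PathSpace Y),
          CayleyKMS.IsKMSMeasure F β m' → m' = m)) := by
  have hex : ∑ s : Y, Real.exp (-β * F s) = 1 →
      ∃ m : ProbabilityMeasure (CayleyKMS.PathSpace Y),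
        CayleyKMS.IsBernoulli m fun s => Real.exp (-β * F s) :=
    CayleyKMS.exists_isBernoulli _ fun s => (Real.exp_pos _).le
  have habel : ∀ m : ProbabilityMeasure (CayleyKMS.PathSpace Y), CayleyKMS.IsKMSMeasure F β m →
      CayleyKMS.IsAbelianMeasure m → CayleyKMS.IsBernoulli m fun s => Real.exp (-β * F s) :=
    fun m hm ha => hm.isBernoulli_of_isAbelianMeasure ha hgen hab
  refine ⟨⟨?_, fun h => ?_⟩, fun m hm ha => ⟨habel m hm ha, fun m' hm' ha' =>
    (habel m' hm' ha').unique (habel m hm ha)⟩, fun hnil => ?_⟩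
  · rintro ⟨m, hm, ha⟩
    exact (habel m hm ha).2.1
  · obtain ⟨m, hm⟩ := hex h
    exact ⟨m, hm.isKMSMeasure, hm.isAbelianMeasure⟩
  · have := CayleyKMS.finite_of_isNilpotent_of_finite_abelianization G hab
    have hber : ∀ m : ProbabilityMeasure (CayleyKMS.PathSpace Y), CayleyKMS.IsKMSMeasure F β m →
        CayleyKMS.IsBernoulli m fun s => Real.exp (-β * F s) :=
      fun m hm => hm.isBernoulli_of_finite hgen
    refine ⟨⟨?_, fun h => ?_⟩, fun m hm => ⟨hber m hm, fun m' hm' => (hber m' hm').unique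
      (hber m hm)⟩⟩
    · rintro ⟨m, hm⟩
      exact (hber m hm).2.1
    · obtain ⟨m, hm⟩ := hex h
      exact ⟨m, hm.isKMSMeasure⟩
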